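/- For $\operatorname{Re} a>0$ let $\zeta(s,a)$ be the Hurwitz zeta function, that is, $\zeta(s,a)=\sum_{n\ge 0}(n+a)^{-s}$ for $\operatorname{Re} s>1$, continued analytically in $s$ to $\mathbb{C}\setminus\{1\}$. Let $\zeta'(s,a)$ be its derivative in $s$, let $\psi=\Gamma'/\Gamma$ be the digamma function, let $\gamma$ be Euler's constant, and for $n=0,1,2,\dots$ put $$g(n,a)=\zeta'(-n,a)+\psi(n+1)\,\zeta(-n,a).$$ **Theorem 1.** For every integer $p\ge 1$ and all complex numbers $a,t$ with $\operatorname{Re} a>0$ and $|t|<\operatorname{Re} a$, the series below converges absolutely, and $$\sum_{n=1}^{\infty}\frac{\zeta(n+1,a)}{n+p}\,t^{n+p}=\frac{t^p}{p}\bigl(\psi(a)+\gamma\bigr)+\sum_{k=0}^{p-1}\binom{p-1}{k}\,g(k,a-t)\,t^{p-1-k}-g(p-1,a),$$ where $t^0=1$, also for $t=0$. -/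

import Mathlib

noncomputable section

/-- The function `z ^ (s - 1) * e ^ (a z) / (1 - e ^ z)`, where the power is taken with the value
`l` of the logarithm of `z`. -/
def hankelKernel (s a l z : ℂ) : ℂ :=
  Complex.exp ((s - 1) * l) * Complex.exp (a * z) / (1 - Complex.exp z)

/-- The integral `I(s) = (1 / 2πi) ∫_L z ^ (s - 1) e ^ (a z) / (1 - e ^ z) dz` over the Hankel
contour `L` of radius `ε` (`0 < ε < 2π`): the lower side `arg z = -π` of the ray `(-∞, -ε)`
traced from left to right, then the circle `z = ε e ^ (iθ)`, `-π ≤ θ ≤ π`, then the upper side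
`arg z = π` of the ray traced from right to left. On the two sides `z = -x`, `dz = -dx`. -/
def hankelIntegral (ε : ℝ) (s a : ℂ) : ℂ :=
  (2 * (Real.pi : ℂ) * Complex.I)⁻¹ *
    ((∫ x in Set.Ioi ε, hankelKernel s a ((Real.log x : ℂ) - Real.pi * Complex.I) (-(x : ℂ)))
      + (∫ θ in (-Real.pi)..Real.pi,
          hankelKernel s a ((Real.log ε : ℂ) + θ * Complex.I) (ε * Complex.exp (θ * Complex.I))
            * (ε * Complex.exp (θ * Complex.I) * Complex.I))
      - ∫ x in Set.Ioi ε, hankelKernel s a ((Real.log x : ℂ) + Real.pi * Complex.I) (-(x : ℂ)))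

theorem hankel_ray_differentiable (a : ℂ) (ha : 0 < a.re) (c : ℂ) :
    Differentiable ℂ (fun s : ℂ => ∫ x in Set.Ioi (1 : ℝ),
      hankelKernel s a ((Real.log x : ℂ) + c) (-(x : ℂ))) := by
  intro s
  set f : ℝ → ℂ := (Set.Ioi (1 : ℝ)).indicator
    (fun x => Complex.exp (a * -(x : ℂ)) / (1 - Complex.exp (-(x : ℂ)))) with hf
  have hE : (fun s : ℂ => ∫ x in Set.Ioi (1 : ℝ),
      hankelKernel s a ((Real.log x : ℂ) + c) (-(x : ℂ)))
      = fun s : ℂ => Complex.exp ((s - 1) * c) * mellin f s := by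
    funext s
    rw [mellin, ← MeasureTheory.integral_const_mul]
    have h1 : ∀ x : ℝ, Complex.exp ((s - 1) * c) * ((x : ℂ) ^ (s - 1) • f x)
        = (Set.Ioi (1 : ℝ)).indicator (fun x : ℝ => Complex.exp ((s - 1) * c) * ((x : ℂ) ^ (s - 1)
          * (Complex.exp (a * -(x : ℂ)) / (1 - Complex.exp (-(x : ℂ)))))) x := by
      intro x
      by_cases hx : x ∈ Set.Ioi (1 : ℝ) <;> simp [hf, hx, smul_eq_mul]
    simp_rw [h1]
    rw [MeasureTheory.setIntegral_indicator measurableSet_Ioi,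
      Set.inter_eq_self_of_subset_right (Set.Ioi_subset_Ioi zero_le_one)]
    refine MeasureTheory.setIntegral_congr_fun measurableSet_Ioi fun x hx => ?_
    have hx0 : (0 : ℝ) < x := lt_trans zero_lt_one hx
    simp only [hankelKernel]
    rw [Complex.cpow_def_of_ne_zero (by exact_mod_cast hx0.ne'), Complex.ofReal_log hx0.le,
      mul_add, Complex.exp_add, mul_comm (Complex.log _) (s - 1)]
    ring
  rw [hE]
  have hne : ∀ x : ℝ, 1 ≤ x → (1 : ℂ) - Complex.exp (-(x : ℂ)) ≠ 0 := by
    intro x hx h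
    have h2 : Real.exp (-x) = 1 := by
      have := sub_eq_zero.1 h
      exact_mod_cast this.symm
    rw [Real.exp_eq_one_iff] at h2
    linarith
  have hloc : MeasureTheory.LocallyIntegrableOn f (Set.Ioi 0) := by
    have hc : ContinuousOn (fun x : ℝ => Complex.exp (a * -(x : ℂ)) / (1 - Complex.exp (-(x : ℂ))))
        (Set.Ici 1) := by
      refine ContinuousOn.div (by fun_prop) (by fun_prop) fun x hx => hne x hx
    rw [hf]
    refine MeasureTheory.LocallyIntegrable.locallyIntegrableOn ?_ _
    have h3 := hc.locallyIntegrableOn (μ := MeasureTheory.volume) measurableSet_Ici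
    have h4 : MeasureTheory.LocallyIntegrable ((Set.Ici (1 : ℝ)).indicator
        (fun x : ℝ => Complex.exp (a * -(x : ℂ)) / (1 - Complex.exp (-(x : ℂ))))) := by
      rw [MeasureTheory.locallyIntegrable_iff]
      intro k hk
      rw [MeasureTheory.IntegrableOn, MeasureTheory.integrable_indicator_iff measurableSet_Ici,
        MeasureTheory.IntegrableOn, MeasureTheory.Measure.restrict_restrict measurableSet_Ici]
      exact (hc.mono Set.inter_subset_left).integrableOn_compact (hk.inter_left isClosed_Ici)
    refine h4.mono (Measurable.aestronglyMeasurable ?_) (Filter.Eventually.of_forall fun x => ?_)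
    · exact Measurable.indicator (by fun_prop) measurableSet_Ioi
    · by_cases hx : x ∈ Set.Ioi (1 : ℝ)
      · have : x ∈ Set.Ici (1 : ℝ) := Set.mem_Ici.2 (Set.mem_Ioi.1 hx).le
        simp [hx, this]
      · simp [hx]
  have hdec : f =O[Filter.atTop] fun x : ℝ => Real.exp (-a.re * x) := by
    refine Asymptotics.IsBigO.of_bound (1 - Real.exp (-1))⁻¹ ?_
    filter_upwards [Filter.eventually_gt_atTop (1 : ℝ)] with x hx
    have hx' : x ∈ Set.Ioi (1 : ℝ) := hx
    have h5 : Real.exp (-1) < 1 := by simp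
    have h6 : 1 - Real.exp (-1) ≤ ‖1 - Complex.exp (-(x : ℂ))‖ := by
      have h7 : (1 : ℂ) - Complex.exp (-(x : ℂ)) = ((1 - Real.exp (-x) : ℝ) : ℂ) := by
        push_cast; rfl
      rw [h7, Complex.norm_real, Real.norm_eq_abs]
      refine le_trans ?_ (le_abs_self _)
      have : Real.exp (-x) ≤ Real.exp (-1) := Real.exp_le_exp.2 (by linarith)
      linarith
    simp only [hf, Set.indicator_of_mem hx', norm_div, Complex.norm_exp, Real.norm_eq_abs,
      Real.abs_exp]
    have h8 : (a * -(x : ℂ)).re = -a.re * x := by simp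
    rw [h8, div_eq_inv_mul]
    gcongr
  have hbot : f =O[nhdsWithin 0 (Set.Ioi 0)] fun x : ℝ => x ^ (-(s.re - 1)) := by
    refine Asymptotics.IsBigO.of_bound 0 ?_
    have : Set.Iio (1 : ℝ) ∈ nhdsWithin (0 : ℝ) (Set.Ioi 0) :=
      mem_nhdsWithin_of_mem_nhds (Iio_mem_nhds zero_lt_one)
    filter_upwards [this] with x hx
    have : x ∉ Set.Ioi (1 : ℝ) := fun h => lt_asymm (Set.mem_Ioi.1 h) (Set.mem_Iio.1 hx)
    simp [hf, this]
  have hm := mellin_differentiableAt_of_isBigO_rpow_exp ha hloc hdec hbot (sub_one_lt _)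
  exact DifferentiableAt.mul (by fun_prop) hm

theorem hankel_circle_differentiable (a : ℂ) :
    Differentiable ℂ (fun s : ℂ => ∫ θ in (-Real.pi)..Real.pi,
      hankelKernel s a ((Real.log (1 : ℝ) : ℂ) + θ * Complex.I)
        (((1 : ℝ) : ℂ) * Complex.exp (θ * Complex.I))
        * (((1 : ℝ) : ℂ) * Complex.exp (θ * Complex.I) * Complex.I)) := by
  have hne : ∀ θ : ℝ, (1 : ℂ) - Complex.exp (Complex.exp (θ * Complex.I)) ≠ 0 := by
    intro θ h
    obtain ⟨n, hn⟩ := Complex.exp_eq_one_iff.1 (sub_eq_zero.1 h).symm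
    have h1 : ‖Complex.exp (θ * Complex.I)‖ = 1 := Complex.norm_exp_ofReal_mul_I θ
    rw [hn] at h1
    simp only [norm_mul, Complex.norm_I, mul_one, Complex.norm_real, Real.norm_eq_abs,
      abs_of_pos Real.pi_pos, Complex.norm_ofNat, Complex.norm_intCast] at h1
    rcases eq_or_ne n 0 with rfl | h0
    · simp at h1
    · have h2 : (1 : ℝ) ≤ |(n : ℝ)| := by exact_mod_cast Int.one_le_abs h0
      nlinarith [Real.pi_gt_three]
  set h : ℝ → ℂ := fun θ => Complex.exp (a * Complex.exp (θ * Complex.I)) /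
    (1 - Complex.exp (Complex.exp (θ * Complex.I))) * (Complex.exp (θ * Complex.I) * Complex.I)
    with hh
  have hcont : Continuous h := by
    refine Continuous.mul (Continuous.div (by fun_prop) (by fun_prop) hne) (by fun_prop)
  have hE : ∀ s : ℂ, (∫ θ in (-Real.pi)..Real.pi,
      hankelKernel s a ((Real.log (1 : ℝ) : ℂ) + θ * Complex.I)
        (((1 : ℝ) : ℂ) * Complex.exp (θ * Complex.I))
        * (((1 : ℝ) : ℂ) * Complex.exp (θ * Complex.I) * Complex.I))
      = ∫ θ in (-Real.pi)..Real.pi, Complex.exp ((s - 1) * (θ * Complex.I)) * h θ := by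
    intro s
    congr 1
    funext θ
    simp only [hankelKernel, hh, Real.log_one, Complex.ofReal_zero, zero_add, Complex.ofReal_one,
      one_mul]
    ring
  simp_rw [hE]
  intro s
  have hc2 : Continuous (fun q : ℂ × ℝ =>
      Complex.exp ((q.1 - 1) * (q.2 * Complex.I)) * (q.2 * Complex.I) * h q.2) := by
    have := hcont.comp (continuous_snd (X := ℂ) (Y := ℝ))
    exact Continuous.mul (by fun_prop) this
  obtain ⟨C, hC⟩ := ((isCompact_closedBall s 1).prod
    (isCompact_Icc (a := -Real.pi) (b := Real.pi))).exists_bound_of_continuousOn hc2.continuousOn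
  have hd := intervalIntegral.hasDerivAt_integral_of_dominated_loc_of_deriv_le
    (μ := MeasureTheory.volume) (a := -Real.pi) (b := Real.pi) (x₀ := s)
    (F := fun s θ => Complex.exp ((s - 1) * (θ * Complex.I)) * h θ)
    (F' := fun s θ => Complex.exp ((s - 1) * (θ * Complex.I)) * (θ * Complex.I) * h θ)
    (s := Metric.closedBall s 1) (bound := fun _ => C)
    (Metric.closedBall_mem_nhds s one_pos)
    (Filter.Eventually.of_forall fun x =>
      (Continuous.mul (by fun_prop) hcont).aestronglyMeasurable)
    ((Continuous.mul (by fun_prop) hcont).intervalIntegrable _ _)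
    ((Continuous.mul (by fun_prop) hcont).aestronglyMeasurable)
    (Filter.Eventually.of_forall fun θ hθ x hx => by
      refine hC (x, θ) ⟨hx, ?_⟩
      rw [Set.uIoc_of_le (by linarith [Real.pi_pos])] at hθ
      exact ⟨hθ.1.le, hθ.2⟩)
    intervalIntegrable_const
    (Filter.Eventually.of_forall fun θ _ x _ => by
      have h1 : HasDerivAt (fun y : ℂ => (y - 1) * (θ * Complex.I)) (1 * (θ * Complex.I)) x :=
        ((hasDerivAt_id x).sub_const 1).mul_const _
      rw [one_mul] at h1
      exact h1.cexp.mul_const _)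
  exact hd.2.differentiableAt

/-- The contour integral `I(s)` is an entire function of `s`. -/
theorem hankelIntegral_differentiable (a : ℂ) (ha : 0 < a.re) :
    Differentiable ℂ (fun s : ℂ => hankelIntegral 1 s a) := by
  have h1 := hankel_ray_differentiable a ha (-(Real.pi * Complex.I))
  have h2 := hankel_ray_differentiable a ha (Real.pi * Complex.I)
  have h3 := hankel_circle_differentiable a
  simp only [← sub_eq_add_neg] at h1
  exact ((h1.add h3).sub h2).const_mul _

/-- The Hurwitz zeta function `ζ(s, a)` for complex `a` with `0 < Re a`: the series
`∑ 1 / (n + a) ^ s` for `1 < Re s`, and its analytic continuation `Γ(1 - s) I(s)` for the other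
`s ≠ 1` (the contour integral does not depend on the radius in `(0, 2π)`, which is taken
to be `1`). The value at the pole `s = 1` is meaningless. -/
def hurwitzZetaC (s a : ℂ) : ℂ :=
  open Classical in
  if 1 < s.re then ∑' n : ℕ, 1 / ((n : ℂ) + a) ^ s
  else Complex.Gamma (1 - s) * hankelIntegral 1 s a

/-- For `Re s < 1` the Hurwitz zeta function is differentiable in `s`, so that the derivatives
`ζ'(-n, a)`, `n = 0, 1, 2, …`, exist. -/
theorem hurwitzZetaC_differentiableAt (a : ℂ) (ha : 0 < a.re) (s : ℂ) (hs : s.re < 1) :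
    DifferentiableAt ℂ (fun s : ℂ => hurwitzZetaC s a) s := by
  have h1 : DifferentiableAt ℂ
      (fun s : ℂ => Complex.Gamma (1 - s) * hankelIntegral 1 s a) s := by
    refine DifferentiableAt.mul ?_ (hankelIntegral_differentiable a ha s)
    have h2 : DifferentiableAt ℂ Complex.Gamma (1 - s) := by
      refine Complex.differentiableAt_Gamma _ fun m h => ?_
      have h3 := congrArg Complex.re h
      simp at h3
      have : (0 : ℝ) ≤ m := m.cast_nonneg
      linarith
    exact h2.comp s (by fun_prop)
  refine h1.congr_of_eventuallyEq ?_
  filter_upwards [(isOpen_lt Complex.continuous_re continuous_const).mem_nhds hs] with y hy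
  rw [hurwitzZetaC, if_neg (not_lt.2 (le_of_lt hy))]

/-- `g(n, a) = ζ'(-n, a) + ψ(n + 1) ζ(-n, a)`, the derivative being with respect to the first
variable of the Hurwitz zeta function. -/
def gFun (n : ℕ) (a : ℂ) : ℂ :=
  deriv (fun s : ℂ => hurwitzZetaC s a) (-(n : ℂ))
    + Complex.digamma ((n : ℂ) + 1) * hurwitzZetaC (-(n : ℂ)) a

end

/-! Write `I(s, a)` for the contour integral and `J(s, a) = ∂I/∂s`. Since `ζ(s, a) = Γ(1 - s) I(s,
a)` for `Re s < 1`, the digamma term in `g` cancels the derivative of the Gamma factor, and `g(n, a)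
= n! J(-n, a)` (`gFun_eq`). Differentiation in `a` multiplies the integrand by `z`, which raises `s`
by one, so `∂J/∂a (s, a) = J(s + 1, a)` (`hasDerivAt_deriv_hankelIntegral`). Hence `∂g(n + 1, a)/∂a
= (n + 1) g(n, a)` and `∂g(0, a)/∂a = J(1, a)`.

By these rules the `t`-derivative of the binomial sum telescopes to `-t ^ (p - 1) J(1, a - t)`
(`hasDerivAt_sum_choose_mul_gFun`). The termwise derivative of the series is `t ^ (p - 1) ∑ ζ(n + 1,
a) t ^ n`. Both sides of the theorem vanish at `t = 0`, so two facts about `J` remain.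

The first is the Taylor series `J(1, a) - J(1, a - t) = ∑ ζ(n + 1, a) t ^ n`. Its coefficients are
the `J(j + 1, a)`, found from `I = ζ / Γ(1 - s)`, where `1 / Γ(1 - s)` has a simple zero at `s = j +
1` (`deriv_hankelIntegral_nat`).

The second is `J(1, a) = ψ(a) + γ` (`deriv_hankelIntegral_one_eq_digamma`). The two sides satisfy
the same difference equation, agree at `a = 1`, and vary little over intervals of length one far to
the right on the real axis. -/

/-! ### Differentiation under the integral sign -/

theorem norm_exp_mul_le_sum (v u e : ℂ) {δ : ℝ} (hδ : 0 < δ) (hv : ‖v - u‖ ≤ δ) :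
    ‖e‖ * ‖Complex.exp (v * e)‖ ≤ δ⁻¹ * (‖Complex.exp ((u + (4 * δ : ℝ)) * e)‖
      + ‖Complex.exp ((u - (4 * δ : ℝ)) * e)‖ + ‖Complex.exp ((u + (4 * δ : ℝ) * Complex.I) * e)‖
      + ‖Complex.exp ((u - (4 * δ : ℝ) * Complex.I) * e)‖) := by
  -- The factor `‖e‖` and the shift from `u` to `v` each cost `exp (δ ‖e‖)`. The resulting `exp (2 δ
  -- ‖e‖)` is absorbed by moving `u` a distance `4 δ` in one of the four axis directions, so the
  -- bound is independent of `v`.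
  have h1 : ‖e‖ ≤ δ⁻¹ * Real.exp (δ * ‖e‖) := by
    rw [inv_mul_eq_div, le_div_iff₀ hδ]
    linarith [Real.add_one_le_exp (δ * ‖e‖)]
  have h2 : ‖Complex.exp (v * e)‖ ≤ Real.exp ((u * e).re + δ * ‖e‖) := by
    rw [Complex.norm_exp]
    refine Real.exp_le_exp.2 ?_
    have h3 : ((v - u) * e).re ≤ δ * ‖e‖ := (Complex.re_le_norm _).trans (by
      rw [norm_mul]; gcongr)
    have h4 : (v * e).re = (u * e).re + ((v - u) * e).re := by
      rw [← Complex.add_re]; congr 1; ring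
    linarith
  have h5 : ‖e‖ * ‖Complex.exp (v * e)‖ ≤ δ⁻¹ * Real.exp ((u * e).re + 2 * δ * ‖e‖) := by
    calc ‖e‖ * ‖Complex.exp (v * e)‖
        ≤ (δ⁻¹ * Real.exp (δ * ‖e‖)) * Real.exp ((u * e).re + δ * ‖e‖) := by gcongr
      _ = _ := by rw [mul_assoc, ← Real.exp_add]; congr 2; ring
  refine h5.trans ?_
  gcongr
  simp only [Complex.norm_exp]
  -- Thus `‖e‖` is at most twice the larger coordinate, whose sign selects the exponential to keep.
  have hr : ‖e‖ ≤ |e.re| + |e.im| := Complex.norm_le_abs_re_add_abs_im e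
  have e1 : ((u + (4 * δ : ℝ)) * e).re = (u * e).re + 4 * δ * e.re := by
    simp [add_mul]
  have e2 : ((u - (4 * δ : ℝ)) * e).re = (u * e).re - 4 * δ * e.re := by
    simp [sub_mul]
  have e3 : ((u + (4 * δ : ℝ) * Complex.I) * e).re = (u * e).re - 4 * δ * e.im := by
    simp [add_mul]; ring
  have e4 : ((u - (4 * δ : ℝ) * Complex.I) * e).re = (u * e).re + 4 * δ * e.im := by
    simp [sub_mul]
  rw [e1, e2, e3, e4]
  have p1 := Real.exp_pos ((u * e).re + 4 * δ * e.re)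
  have p2 := Real.exp_pos ((u * e).re - 4 * δ * e.re)
  have p3 := Real.exp_pos ((u * e).re - 4 * δ * e.im)
  have p4 := Real.exp_pos ((u * e).re + 4 * δ * e.im)
  rcases le_total |e.re| |e.im| with h | h
  · have h6 : ‖e‖ ≤ 2 * |e.im| := by linarith
    have h7 : 2 * δ * ‖e‖ ≤ 4 * δ * |e.im| := by nlinarith
    rcases abs_cases e.im with ⟨h8, -⟩ | ⟨h8, -⟩
    · have : Real.exp ((u * e).re + 2 * δ * ‖e‖) ≤ Real.exp ((u * e).re + 4 * δ * e.im) :=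
        Real.exp_le_exp.2 (by rw [h8] at h7; linarith)
      linarith
    · have : Real.exp ((u * e).re + 2 * δ * ‖e‖) ≤ Real.exp ((u * e).re - 4 * δ * e.im) :=
        Real.exp_le_exp.2 (by rw [h8] at h7; linarith)
      linarith
  · have h6 : ‖e‖ ≤ 2 * |e.re| := by linarith
    have h7 : 2 * δ * ‖e‖ ≤ 4 * δ * |e.re| := by nlinarith
    rcases abs_cases e.re with ⟨h8, -⟩ | ⟨h8, -⟩
    · have : Real.exp ((u * e).re + 2 * δ * ‖e‖) ≤ Real.exp ((u * e).re + 4 * δ * e.re) :=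
        Real.exp_le_exp.2 (by rw [h8] at h7; linarith)
      linarith
    · have : Real.exp ((u * e).re + 2 * δ * ‖e‖) ≤ Real.exp ((u * e).re - 4 * δ * e.re) :=
        Real.exp_le_exp.2 (by rw [h8] at h7; linarith)
      linarith

/-- An integral `∫ exp (u e) w` that converges for all `u` in an open set may be differentiated
under the integral sign there. -/
theorem hasDerivAt_integral_exp_mul {α : Type*} [MeasurableSpace α]
    {μ : MeasureTheory.Measure α} {e w : α → ℂ} {U : Set ℂ} (hU : IsOpen U)
    (he : MeasureTheory.AEStronglyMeasurable e μ)
    (hint : ∀ u ∈ U, MeasureTheory.Integrable (fun x => Complex.exp (u * e x) * w x) μ)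
    {u : ℂ} (hu : u ∈ U) :
    MeasureTheory.Integrable (fun x => Complex.exp (u * e x) * (e x * w x)) μ ∧
      HasDerivAt (fun u => ∫ x, Complex.exp (u * e x) * w x ∂μ)
        (∫ x, Complex.exp (u * e x) * (e x * w x) ∂μ) u := by
  obtain ⟨r, hr, hrU⟩ := Metric.isOpen_iff.1 hU u hu
  -- The four points at distance `4 δ = r / 2` from `u` then lie in `U`.
  set δ := r / 8 with hδ
  have hδ0 : 0 < δ := by positivity
  have hw : MeasureTheory.AEStronglyMeasurable w μ := by
    have h1 := (hint u hu).aestronglyMeasurable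
    have h2 : MeasureTheory.AEStronglyMeasurable (fun x => Complex.exp (-(u * e x))) μ :=
      Complex.continuous_exp.comp_aestronglyMeasurable (he.const_mul u).neg
    refine (h2.mul h1).congr (Filter.Eventually.of_forall fun x => ?_)
    simp only [Pi.mul_apply]
    rw [← mul_assoc, ← Complex.exp_add, neg_add_cancel, Complex.exp_zero, one_mul]
  have hexp : ∀ v : ℂ, MeasureTheory.AEStronglyMeasurable (fun x => Complex.exp (v * e x)) μ :=
    fun v => Complex.continuous_exp.comp_aestronglyMeasurable (he.const_mul v)
  have hmem : ∀ d : ℂ, ‖d‖ = 4 * δ → u + d ∈ U := fun d hd => hrU (by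
    rw [Metric.mem_ball, dist_eq_norm, add_sub_cancel_left, hd, hδ]; linarith)
  have n1 : ‖((4 * δ : ℝ) : ℂ)‖ = 4 * δ := by
    rw [Complex.norm_real, Real.norm_of_nonneg (by positivity)]
  have i1 := (hint _ (hmem (4 * δ : ℝ) n1)).norm
  have i2 := (hint _ (hmem (-(4 * δ : ℝ)) (by rw [norm_neg, n1]))).norm
  have i3 := (hint _ (hmem ((4 * δ : ℝ) * Complex.I) (by rw [norm_mul, n1]; simp))).norm
  have i4 := (hint _ (hmem (-((4 * δ : ℝ) * Complex.I)) (by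
    rw [norm_neg, norm_mul, n1]; simp))).norm
  refine hasDerivAt_integral_of_dominated_loc_of_deriv_le
    (F := fun u x => Complex.exp (u * e x) * w x)
    (F' := fun u x => Complex.exp (u * e x) * (e x * w x))
    (Metric.closedBall_mem_nhds u hδ0)
    (Filter.Eventually.of_forall fun v => (hexp v).mul hw) (hint u hu)
    ((hexp u).mul (he.mul hw)) (Filter.Eventually.of_forall fun x v hv => ?_)
    ((((i1.add i2).add i3).add i4).const_mul δ⁻¹)
    (Filter.Eventually.of_forall fun x v _ => ?_)
  · have := norm_exp_mul_le_sum v u (e x) hδ0 (by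
      rw [← dist_eq_norm]; exact Metric.mem_closedBall.1 hv)
    calc ‖Complex.exp (v * e x) * (e x * w x)‖
        = (‖e x‖ * ‖Complex.exp (v * e x)‖) * ‖w x‖ := by simp only [norm_mul]; ring
      _ ≤ _ := mul_le_mul_of_nonneg_right this (norm_nonneg _)
      _ = _ := by simp only [norm_mul, Pi.add_apply, ← sub_eq_add_neg]; ring
  · have h1 : HasDerivAt (fun y : ℂ => y * e x) (1 * e x) v := (hasDerivAt_id v).mul_const _
    rw [one_mul] at h1
    exact (h1.cexp.mul_const (w x)).congr_deriv (by ring)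

/-- The derivative in `s` of the integral of `z ^ (s - 1) e ^ (a z) w`, with `l` a logarithm
of `z`, and the derivative in `a` of that derivative. -/
theorem hasDerivAt_integral_exp_log_mul {α : Type*} [MeasurableSpace α]
    {μ : MeasureTheory.Measure α} {l z w : α → ℂ}
    (hl : MeasureTheory.AEStronglyMeasurable l μ) (hz : ∀ᵐ x ∂μ, Complex.exp (l x) = z x)
    (hint : ∀ s a : ℂ, 0 < a.re → MeasureTheory.Integrable
      (fun x => Complex.exp ((s - 1) * l x) * Complex.exp (a * z x) * w x) μ)
    (s : ℂ) {a : ℂ} (ha : 0 < a.re) :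
    HasDerivAt (fun s => ∫ x, Complex.exp ((s - 1) * l x) * Complex.exp (a * z x) * w x ∂μ)
        (∫ x, l x * Complex.exp ((s - 1) * l x) * Complex.exp (a * z x) * w x ∂μ) s ∧
      HasDerivAt
        (fun a => ∫ x, l x * Complex.exp ((s - 1) * l x) * Complex.exp (a * z x) * w x ∂μ)
        (∫ x, l x * Complex.exp ((s + 1 - 1) * l x) * Complex.exp (a * z x) * w x ∂μ) a := by
  have hS : ∀ b : ℂ, 0 < b.re → ∀ s : ℂ,
      MeasureTheory.Integrable
        (fun x => l x * Complex.exp ((s - 1) * l x) * Complex.exp (b * z x) * w x) μ ∧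
      HasDerivAt (fun s => ∫ x, Complex.exp ((s - 1) * l x) * Complex.exp (b * z x) * w x ∂μ)
        (∫ x, l x * Complex.exp ((s - 1) * l x) * Complex.exp (b * z x) * w x ∂μ) s := by
    intro b hb s
    -- Here `s - 1` is the parameter and the logarithm is the exponent function. The integrability
    -- obtained for the differentiated integrand is what the later differentiation in `a` needs.
    have h := hasDerivAt_integral_exp_mul (μ := μ) (e := l)
      (w := fun x => Complex.exp (b * z x) * w x) (U := Set.univ) isOpen_univ hl
      (fun u _ => by simpa [mul_assoc] using hint (u + 1) b hb) (Set.mem_univ (s - 1))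
    refine ⟨h.1.congr (Filter.Eventually.of_forall fun x => by ring), ?_⟩
    have h2 := h.2.comp_sub_const s 1
    simp only [mul_assoc] at h2 ⊢
    refine h2.congr_deriv (MeasureTheory.integral_congr_ae
      (Filter.Eventually.of_forall fun x => by ring))
  refine ⟨(hS a ha s).2, ?_⟩
  have hzm : MeasureTheory.AEStronglyMeasurable z μ :=
    (Complex.continuous_exp.comp_aestronglyMeasurable hl).congr hz
  have h := hasDerivAt_integral_exp_mul (μ := μ) (e := z)
      (w := fun x => l x * Complex.exp ((s - 1) * l x) * w x) (U := {a | 0 < a.re})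
      (isOpen_lt continuous_const Complex.continuous_re) hzm
      (fun b hb => ((hS b hb s).1).congr (Filter.Eventually.of_forall fun x => by ring)) ha
  have h2 : (fun a => ∫ x, l x * Complex.exp ((s - 1) * l x) * Complex.exp (a * z x) * w x ∂μ)
      = fun a => ∫ x, Complex.exp (a * z x) * (l x * Complex.exp ((s - 1) * l x) * w x) ∂μ := by
    funext b
    exact MeasureTheory.integral_congr_ae (Filter.Eventually.of_forall fun x => by ring)
  rw [h2]
  refine h.2.congr_deriv (MeasureTheory.integral_congr_ae ?_)
  filter_upwards [hz] with x hx
  -- The factor `z = exp l` brought down by `∂/∂a` raises `s` by one.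
  rw [add_sub_cancel_right, show s * l x = (s - 1) * l x + l x by ring, Complex.exp_add, hx]
  ring

/-! ### The kernel on the contour and the derivatives of the contour integral -/

/-- From `1 + x ≤ e ^ x` follows `1 / (1 - e ^ (-x)) ≤ 1 / x + 1`. The term `1 / x` lowers one
exponent to `Re s - 2`, which is why integrability down to `0` is obtained for `1 < Re s`. -/
theorem norm_hankelKernel_ray_le (s a c : ℂ) {x : ℝ} (hx : 0 < x) :
    ‖hankelKernel s a ((Real.log x : ℂ) + c) (-(x : ℂ))‖ ≤
      Real.exp ((s - 1) * c).re * (x ^ (s.re - 2) * Real.exp (-a.re * x)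
        + x ^ (s.re - 1) * Real.exp (-a.re * x)) := by
  have h0 : 0 < 1 - Real.exp (-x) := by
    have : Real.exp (-x) < 1 := by simpa using hx
    linarith
  have h1 : ‖(1 : ℂ) - Complex.exp (-(x : ℂ))‖ = 1 - Real.exp (-x) := by
    rw [← Complex.ofReal_neg, ← Complex.ofReal_exp, ← Complex.ofReal_one, ← Complex.ofReal_sub,
      Complex.norm_real, Real.norm_of_nonneg h0.le]
  have h2 : (1 - Real.exp (-x))⁻¹ ≤ x⁻¹ + 1 := by
    rw [inv_le_iff_one_le_mul₀ h0]
    have h3 : Real.exp (-x) * (x + 1) ≤ 1 := by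
      calc Real.exp (-x) * (x + 1) ≤ Real.exp (-x) * Real.exp x := by
            gcongr; exact Real.add_one_le_exp x
        _ = 1 := by rw [← Real.exp_add]; simp
    have h4 : (x⁻¹ + 1) * (1 - Real.exp (-x)) = x⁻¹ * (x + 1 - Real.exp (-x) * (x + 1)) := by
      field_simp
      ring
    rw [h4, ← inv_mul_cancel₀ hx.ne']
    gcongr
    linarith
  have h5 : ‖Complex.exp ((s - 1) * ((Real.log x : ℂ) + c))‖
      = Real.exp ((s - 1) * c).re * x ^ (s.re - 1) := by
    rw [Complex.norm_exp, Real.rpow_def_of_pos hx, ← Real.exp_add, mul_add, Complex.add_re,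
      Complex.re_mul_ofReal]
    congr 1
    simp
    ring
  have h6 : ‖Complex.exp (a * -(x : ℂ))‖ = Real.exp (-a.re * x) := by
    rw [Complex.norm_exp]; simp
  have h7 : x ^ (s.re - 2) = x ^ (s.re - 1) * x⁻¹ := by
    rw [← Real.rpow_neg_one x, ← Real.rpow_add hx]; congr 1; ring
  rw [hankelKernel, norm_div, norm_mul, h1, h5, h6, h7, div_eq_mul_inv]
  calc _ ≤ Real.exp ((s - 1) * c).re * x ^ (s.re - 1) * Real.exp (-a.re * x) * (x⁻¹ + 1) := by
        gcongr
    _ = _ := by ring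

theorem measurable_hankelKernel_ray (s a c : ℂ) :
    Measurable (fun x : ℝ => hankelKernel s a ((Real.log x : ℂ) + c) (-(x : ℂ))) := by
  unfold hankelKernel
  fun_prop

theorem integrableOn_hankelKernel_ray {s a : ℂ} (hs : 1 < s.re) (ha : 0 < a.re) (c : ℂ) :
    MeasureTheory.IntegrableOn
      (fun x : ℝ => hankelKernel s a ((Real.log x : ℂ) + c) (-(x : ℂ))) (Set.Ioi 0) := by
  have h1 := integrableOn_rpow_mul_exp_neg_mul_rpow (p := 1) (s := s.re - 2) (by linarith)
    one_pos ha
  have h2 := integrableOn_rpow_mul_exp_neg_mul_rpow (p := 1) (s := s.re - 1) (by linarith)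
    one_pos ha
  simp only [Real.rpow_one] at h1 h2
  refine MeasureTheory.Integrable.mono'
    ((h1.add h2).const_mul (Real.exp ((s - 1) * c).re))
    (measurable_hankelKernel_ray s a c).aestronglyMeasurable ?_
  filter_upwards [MeasureTheory.ae_restrict_mem measurableSet_Ioi] with x hx
  exact norm_hankelKernel_ray_le s a c hx

theorem integrableOn_hankelKernel_ray_one (s : ℂ) {a : ℂ} (ha : 0 < a.re) (c : ℂ) :
    MeasureTheory.IntegrableOn
      (fun x : ℝ => hankelKernel s a ((Real.log x : ℂ) + c) (-(x : ℂ))) (Set.Ioi 1) := by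
  -- On `x ≥ 1` a larger exponent only enlarges the bound, and `N ≥ 2` makes the majorant integrable
  -- on all of `(0, ∞)`.
  set N := max s.re 2 with hN
  have hN2 : 2 ≤ N := le_max_right _ _
  have hNs : s.re ≤ N := le_max_left _ _
  have h1 := integrableOn_rpow_mul_exp_neg_mul_rpow (p := 1) (s := N - 2) (by linarith)
    one_pos ha
  have h2 := integrableOn_rpow_mul_exp_neg_mul_rpow (p := 1) (s := N - 1) (by linarith)
    one_pos ha
  simp only [Real.rpow_one] at h1 h2
  have h3 := (h1.add h2).mono_set (Set.Ioi_subset_Ioi (zero_le_one (α := ℝ)))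
  refine MeasureTheory.Integrable.mono' (h3.const_mul (Real.exp ((s - 1) * c).re))
    (measurable_hankelKernel_ray s a c).aestronglyMeasurable ?_
  filter_upwards [MeasureTheory.ae_restrict_mem measurableSet_Ioi] with x hx
  have hx1 : (1 : ℝ) ≤ x := (Set.mem_Ioi.1 hx).le
  refine (norm_hankelKernel_ray_le s a c (lt_of_lt_of_le one_pos hx1)).trans ?_
  simp only [Pi.add_apply]
  gcongr

/-- The point `exp w` is nonzero and in the closed unit disc, while the nonzero zeros of `1 - exp z`
have modulus at least `2π`. -/
theorem one_sub_exp_exp_ne_zero (w : ℂ) (hw : w.re ≤ 0) :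
    (1 : ℂ) - Complex.exp (Complex.exp w) ≠ 0 := by
  intro h
  obtain ⟨n, hn⟩ := Complex.exp_eq_one_iff.1 (sub_eq_zero.1 h).symm
  have h1 : ‖Complex.exp w‖ ≤ 1 := by
    rw [Complex.norm_exp]; exact Real.exp_le_one_iff.2 hw
  have hn0 : n ≠ 0 := fun h0 => Complex.exp_ne_zero w (by rw [hn, h0]; simp)
  rw [hn] at h1
  simp only [norm_mul, Complex.norm_I, mul_one, Complex.norm_real, Real.norm_eq_abs,
    abs_of_pos Real.pi_pos, Complex.norm_ofNat, Complex.norm_intCast] at h1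
  have h2 : (1 : ℝ) ≤ |(n : ℝ)| := by exact_mod_cast Int.one_le_abs hn0
  nlinarith [Real.pi_gt_three]

/-- The derivative in `a` of `∂I/∂s (s, a)` is `∂I/∂s (s + 1, a)`. -/
theorem hasDerivAt_deriv_hankelIntegral (s : ℂ) {a : ℂ} (ha : 0 < a.re) :
    HasDerivAt (fun a => deriv (fun s => hankelIntegral 1 s a) s)
      (deriv (fun s => hankelIntegral 1 s a) (s + 1)) a := by
  -- With `c = ±πi`, `log x + c` is the logarithm of `-x` on the two sides of the cut.
  have hray : ∀ c : ℂ, Complex.exp c = -1 → ∀ (s a : ℂ), 0 < a.re → _ :=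
    fun c hc s a ha => hasDerivAt_integral_exp_log_mul
      (μ := MeasureTheory.volume.restrict (Set.Ioi (1 : ℝ)))
      (l := fun x => (Real.log x : ℂ) + c) (z := fun x => -(x : ℂ))
      (w := fun x => (1 - Complex.exp (-(x : ℂ)))⁻¹)
      (by fun_prop)
      (by
        filter_upwards [MeasureTheory.ae_restrict_mem measurableSet_Ioi] with x hx
        rw [Complex.exp_add, hc, ← Complex.ofReal_exp,
          Real.exp_log (lt_trans one_pos (Set.mem_Ioi.1 hx)), mul_neg_one])
      (fun s a ha => integrableOn_hankelKernel_ray_one s ha c) s ha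
  have h1 := hray (-(Real.pi * Complex.I)) (by rw [Complex.exp_neg, Complex.exp_pi_mul_I]; norm_num)
  have h2 := hray (Real.pi * Complex.I) Complex.exp_pi_mul_I
  have hne : ∀ θ : ℝ, (1 : ℂ) - Complex.exp (Complex.exp (θ * Complex.I)) ≠ 0 := fun θ =>
    one_sub_exp_exp_ne_zero _ (by simp)
  have h3 : ∀ (s a : ℂ), 0 < a.re → _ :=
    fun s a ha => hasDerivAt_integral_exp_log_mul
      (μ := MeasureTheory.volume.restrict (Set.Ioc (-Real.pi) Real.pi))
      (l := fun θ : ℝ => (θ : ℂ) * Complex.I) (z := fun θ : ℝ => Complex.exp (θ * Complex.I))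
      (w := fun θ => (1 - Complex.exp (Complex.exp (θ * Complex.I)))⁻¹
        * (Complex.exp (θ * Complex.I) * Complex.I))
      (by fun_prop) (Filter.Eventually.of_forall fun _ => rfl)
      (fun s a _ => by
        refine (Continuous.integrableOn_Ioc ?_)
        exact Continuous.mul (by fun_prop)
          (Continuous.mul (Continuous.inv₀ (by fun_prop) hne) (by fun_prop))) s ha
  have hH : ∀ s a : ℂ, hankelIntegral 1 s a = (2 * (Real.pi : ℂ) * Complex.I)⁻¹ *
      ((∫ x in Set.Ioi (1 : ℝ), Complex.exp ((s - 1) * ((Real.log x : ℂ) + -(Real.pi * Complex.I)))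
          * Complex.exp (a * -(x : ℂ)) * (1 - Complex.exp (-(x : ℂ)))⁻¹)
        + (∫ θ in Set.Ioc (-Real.pi) Real.pi, Complex.exp ((s - 1) * (θ * Complex.I))
            * Complex.exp (a * Complex.exp (θ * Complex.I))
            * ((1 - Complex.exp (Complex.exp (θ * Complex.I)))⁻¹
              * (Complex.exp (θ * Complex.I) * Complex.I)))
        - ∫ x in Set.Ioi (1 : ℝ), Complex.exp ((s - 1) * ((Real.log x : ℂ) + Real.pi * Complex.I))
          * Complex.exp (a * -(x : ℂ)) * (1 - Complex.exp (-(x : ℂ)))⁻¹) := by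
    intro s a
    rw [hankelIntegral, intervalIntegral.integral_of_le (by linarith [Real.pi_pos])]
    simp only [hankelKernel, Real.log_one, Complex.ofReal_zero, zero_add, Complex.ofReal_one,
      one_mul, div_eq_mul_inv, sub_eq_add_neg, mul_assoc]
  have hd : ∀ (s a : ℂ), 0 < a.re → _ := fun s a ha =>
    ((((h1 s a ha).1.fun_add (h3 s a ha).1).fun_sub (h2 s a ha).1).const_mul
      (2 * (Real.pi : ℂ) * Complex.I)⁻¹)
  have hda := ((((h1 s a ha).2.fun_add (h3 s a ha).2).fun_sub (h2 s a ha).2).const_mul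
      (2 * (Real.pi : ℂ) * Complex.I)⁻¹)
  simp_rw [hH]
  rw [(hd (s + 1) a ha).deriv]
  refine hda.congr_of_eventuallyEq ?_
  filter_upwards [(isOpen_lt continuous_const Complex.continuous_re).mem_nhds ha] with b hb
  exact (hd s b hb).deriv

/-! ### The functions `g(n, a)` and their derivatives in `a` -/

theorem deriv_Gamma_eq_digamma_mul_factorial (n : ℕ) :
    deriv Complex.Gamma ((n : ℂ) + 1) = Complex.digamma ((n : ℂ) + 1) * (n.factorial : ℂ) := by
  rw [Complex.digamma_def, logDeriv_apply, Complex.Gamma_nat_eq_factorial,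
    div_mul_cancel₀ _ (by exact_mod_cast n.factorial_ne_zero)]

/-- Differentiating `Γ(1 - s) I(s, a)` at `s = -n` gives `-Γ'(n + 1) I + n! ∂I/∂s`. Since `Γ'(n + 1)
= ψ(n + 1) n!`, the first term is cancelled by `ψ(n + 1) ζ(-n, a)`. -/
theorem gFun_eq (n : ℕ) {a : ℂ} (ha : 0 < a.re) :
    gFun n a = n.factorial * deriv (fun s => hankelIntegral 1 s a) (-(n : ℂ)) := by
  have hn : (-(n : ℂ)).re < 1 := by
    have : (0 : ℝ) ≤ n := n.cast_nonneg
    simp; linarith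
  have hev : (fun s : ℂ => hurwitzZetaC s a) =ᶠ[nhds (-(n : ℂ))]
      fun s => Complex.Gamma (1 - s) * hankelIntegral 1 s a := by
    filter_upwards [(isOpen_lt Complex.continuous_re continuous_const).mem_nhds hn] with y hy
    rw [hurwitzZetaC, if_neg (not_lt.2 (le_of_lt hy))]
  have hG : HasDerivAt (fun s : ℂ => Complex.Gamma (1 - s))
      (-deriv Complex.Gamma ((n : ℂ) + 1)) (-(n : ℂ)) := by
    have h1 := (Complex.differentiableAt_Gamma_nat_add_one n).hasDerivAt
    have h2 : (1 : ℂ) - -(n : ℂ) = n + 1 := by ring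
    have h3 : HasDerivAt (fun s : ℂ => 1 - s) (-1) (-(n : ℂ)) := by
      simpa using (hasDerivAt_id (-(n : ℂ))).const_sub 1
    rw [← h2] at h1 ⊢
    exact (h1.comp (-(n : ℂ)) h3).congr_deriv (by ring)
  have hd := hG.mul (hankelIntegral_differentiable a ha (-(n : ℂ))).hasDerivAt
  have h4 := hev.eq_of_nhds
  rw [gFun, hev.deriv_eq, h4, show (fun s => Complex.Gamma (1 - s) * hankelIntegral 1 s a)
    = (fun s => Complex.Gamma (1 - s)) * (fun s => hankelIntegral 1 s a) from rfl, hd.deriv,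
    deriv_Gamma_eq_digamma_mul_factorial, show (1 : ℂ) - -(n : ℂ) = n + 1 by ring,
    Complex.Gamma_nat_eq_factorial]
  ring

theorem hasDerivAt_gFun_succ (n : ℕ) {a : ℂ} (ha : 0 < a.re) :
    HasDerivAt (gFun (n + 1)) ((n + 1 : ℕ) * gFun n a) a := by
  have h := (hasDerivAt_deriv_hankelIntegral (-((n + 1 : ℕ) : ℂ)) ha).const_mul
    (((n + 1).factorial : ℕ) : ℂ)
  have h2 : -((n + 1 : ℕ) : ℂ) + 1 = -(n : ℂ) := by push_cast; ring
  rw [h2] at h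
  refine (h.congr_of_eventuallyEq ?_).congr_deriv ?_
  · filter_upwards [(isOpen_lt continuous_const Complex.continuous_re).mem_nhds ha] with b hb
    exact gFun_eq _ hb
  · rw [gFun_eq n ha, Nat.factorial_succ]; push_cast; ring

theorem hasDerivAt_gFun_zero {a : ℂ} (ha : 0 < a.re) :
    HasDerivAt (gFun 0) (deriv (fun s => hankelIntegral 1 s a) 1) a := by
  have h := hasDerivAt_deriv_hankelIntegral 0 ha
  rw [zero_add] at h
  refine h.congr_of_eventuallyEq ?_
  filter_upwards [(isOpen_lt continuous_const Complex.continuous_re).mem_nhds ha] with b hb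
  simpa using gFun_eq 0 hb

/-! ### Shrinking the contour onto the cut for `1 < Re s` -/

/-- The substitution `x = e ^ u` passes to the logarithmic plane, where a ray piece becomes a
horizontal side of a rectangle. -/
theorem integral_hankelKernel_ray_eq_integral_exp (s a c : ℂ) (hc : Complex.exp c = -1)
    {ε : ℝ} (hε : 0 < ε) :
    ∫ x in ε..1, hankelKernel s a ((Real.log x : ℂ) + c) (-(x : ℂ))
      = -∫ u in (Real.log ε)..0, hankelKernel s a (u + c) (Complex.exp (u + c))
          * Complex.exp (u + c) := by
  have hcont : ContinuousOn (fun x : ℝ => hankelKernel s a ((Real.log x : ℂ) + c) (-(x : ℂ)))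
      (Real.exp '' Set.uIcc (Real.log ε) 0) := by
    rintro x ⟨u, -, rfl⟩
    refine ContinuousAt.continuousWithinAt ?_
    have h1 : (1 : ℂ) - Complex.exp (-(Real.exp u : ℂ)) ≠ 0 := by
      rw [← Complex.ofReal_neg, ← Complex.ofReal_exp, ← Complex.ofReal_one, ← Complex.ofReal_sub]
      exact_mod_cast (sub_pos.2 (by simpa using Real.exp_pos u : Real.exp (-Real.exp u) < 1)).ne'
    have h2 : ContinuousAt Real.log (Real.exp u) := Real.continuousAt_log (Real.exp_pos u).ne'
    unfold hankelKernel
    refine ContinuousAt.div ?_ (by fun_prop) h1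
    fun_prop
  have h := intervalIntegral.integral_deriv_smul_comp' (a := Real.log ε) (b := 0)
    (fun x _ => Real.hasDerivAt_exp x) Real.continuous_exp.continuousOn hcont
  rw [Real.exp_log hε, Real.exp_zero] at h
  rw [← h, ← intervalIntegral.integral_neg]
  refine intervalIntegral.integral_congr fun u _ => ?_
  simp only [Function.comp_apply, Real.log_exp, Complex.exp_add, hc, Complex.real_smul,
    Complex.ofReal_exp]
  ring_nf

/-- The contour integral does not depend on the radius. -/
theorem hankelIntegral_one_eq {ε : ℝ} (hε : 0 < ε) (hε1 : ε ≤ 1) {s a : ℂ} (hs : 1 < s.re)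
    (ha : 0 < a.re) : hankelIntegral 1 s a = hankelIntegral ε s a := by
  -- In the variable `w = log z` the cut annulus between radii `ε` and `1` is the rectangle `log ε ≤
  -- Re w ≤ 0`, `|Im w| ≤ π`. The integrand is holomorphic there, so Cauchy's theorem applies
  -- without a branch cut.
  set f : ℂ → ℂ := fun w => hankelKernel s a w (Complex.exp w) * Complex.exp w with hf
  have hlog : Real.log ε ≤ 0 := Real.log_nonpos hε.le hε1
  have hd : DifferentiableOn ℂ f (Set.uIcc ((Real.log ε : ℂ) + (-Real.pi : ℝ) * Complex.I).re
      (((0 : ℝ) : ℂ) + (Real.pi : ℝ) * Complex.I).re ×ℂ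
      Set.uIcc ((Real.log ε : ℂ) + (-Real.pi : ℝ) * Complex.I).im
        (((0 : ℝ) : ℂ) + (Real.pi : ℝ) * Complex.I).im) := by
    intro w hw
    have hw0 : w.re ≤ 0 := by
      have h1 := hw.1
      simp only [Complex.add_re, Complex.ofReal_re, Complex.re_ofReal_mul, Complex.I_re, mul_zero,
        add_zero, Set.mem_preimage] at h1
      rw [Set.uIcc_of_le hlog] at h1
      exact h1.2
    refine DifferentiableAt.differentiableWithinAt ?_
    simp only [hf, hankelKernel]
    refine DifferentiableAt.mul (DifferentiableAt.div (by fun_prop) (by fun_prop)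
      (one_sub_exp_exp_ne_zero w hw0)) (by fun_prop)
  have hrect := Complex.integral_boundary_rect_eq_zero_of_differentiableOn f _ _ hd
  simp only [Complex.add_re, Complex.ofReal_re, Complex.re_ofReal_mul, Complex.I_re, mul_zero,
    add_zero, Complex.add_im, Complex.ofReal_im, Complex.im_ofReal_mul, Complex.I_im, mul_one,
    zero_add, smul_eq_mul] at hrect
  have hray : ∀ c : ℂ, Complex.exp c = -1 →
      (∫ x in Set.Ioi ε, hankelKernel s a ((Real.log x : ℂ) + c) (-(x : ℂ)))
        - ∫ x in Set.Ioi (1 : ℝ), hankelKernel s a ((Real.log x : ℂ) + c) (-(x : ℂ))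
        = -∫ u in (Real.log ε)..0, f (u + c) := by
    intro c hc
    rw [intervalIntegral.integral_Ioi_sub_Ioi
      ((integrableOn_hankelKernel_ray hs ha c).mono_set (Set.Ioi_subset_Ioi hε.le)) hε1,
      integral_hankelKernel_ray_eq_integral_exp s a c hc hε]
  have h1 := hray (-(Real.pi * Complex.I)) (by rw [Complex.exp_neg, Complex.exp_pi_mul_I]; norm_num)
  have h2 := hray (Real.pi * Complex.I) Complex.exp_pi_mul_I
  have hcirc : ∀ r : ℝ, 0 < r → (∫ θ in (-Real.pi)..Real.pi,
          hankelKernel s a ((Real.log r : ℂ) + θ * Complex.I) (r * Complex.exp (θ * Complex.I))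
            * (r * Complex.exp (θ * Complex.I) * Complex.I))
      = Complex.I * ∫ θ in (-Real.pi)..Real.pi, f ((Real.log r : ℂ) + θ * Complex.I) := by
    intro r hr
    rw [← intervalIntegral.integral_const_mul]
    refine intervalIntegral.integral_congr fun θ _ => ?_
    simp only [hf, Complex.exp_add, ← Complex.ofReal_exp, Real.exp_log hr]
    ring
  have h3 := hcirc ε hε
  have h4 := hcirc 1 one_pos
  simp only [sub_eq_add_neg, neg_mul, Complex.ofReal_neg] at h1 h2 hrect
  rw [Real.log_one] at h4
  simp only [hankelIntegral, sub_eq_add_neg, Real.log_one]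
  rw [h3, h4]
  congr 1
  linear_combination -h1 + h2 + hrect

/-- From `|e ^ z - 1 - z| ≤ |z| ^ 2` and `|z| = ε ≤ 1 / 2` one gets `|1 - e ^ z| ≥ ε / 2`, which
offsets the factor `ε` of `dz`. What remains tends to `0` with `ε` when `1 < Re s`. -/
theorem norm_hankelKernel_circle_le (s a : ℂ) {ε : ℝ} (hε : 0 < ε) (hε1 : ε ≤ 1 / 2) {θ : ℝ}
    (hθ : |θ| ≤ Real.pi) :
    ‖hankelKernel s a ((Real.log ε : ℂ) + θ * Complex.I) (ε * Complex.exp (θ * Complex.I))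
      * (ε * Complex.exp (θ * Complex.I) * Complex.I)‖
      ≤ Real.exp (|s.im| * Real.pi) * Real.exp ‖a‖ * 2 * ε ^ (s.re - 1) := by
  set z : ℂ := ε * Complex.exp (θ * Complex.I) with hz
  have hzn : ‖z‖ = ε := by
    rw [hz, norm_mul, Complex.norm_exp_ofReal_mul_I, mul_one, Complex.norm_real,
      Real.norm_of_nonneg hε.le]
  have h1 : ε / 2 ≤ ‖1 - Complex.exp z‖ := by
    have h2 := Complex.norm_exp_sub_one_sub_id_le (x := z) (by rw [hzn]; linarith)
    have h3 : ‖z‖ ≤ ‖Complex.exp z - 1 - z‖ + ‖1 - Complex.exp z‖ := by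
      rw [← norm_neg z]
      refine le_trans (le_of_eq ?_) (norm_add_le _ _)
      congr 1; ring
    rw [hzn] at h2 h3
    nlinarith
  have h4 : ‖Complex.exp ((s - 1) * ((Real.log ε : ℂ) + θ * Complex.I))‖
      ≤ Real.exp (|s.im| * Real.pi) * ε ^ (s.re - 1) := by
    rw [Complex.norm_exp, Real.rpow_def_of_pos hε, ← Real.exp_add]
    refine Real.exp_le_exp.2 ?_
    have h5 : ((s - 1) * ((Real.log ε : ℂ) + θ * Complex.I)).re
        = Real.log ε * (s.re - 1) - s.im * θ := by
      simp; ring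
    have h6 : -(s.im * θ) ≤ |s.im| * Real.pi := by
      calc -(s.im * θ) ≤ |s.im * θ| := neg_le_abs _
        _ = |s.im| * |θ| := abs_mul _ _
        _ ≤ _ := by gcongr
    rw [h5]; linarith
  have h7 : ‖Complex.exp (a * z)‖ ≤ Real.exp ‖a‖ := by
    rw [Complex.norm_exp]
    refine Real.exp_le_exp.2 ((Complex.re_le_norm _).trans ?_)
    rw [norm_mul, hzn]
    nlinarith [norm_nonneg a]
  have h8 : ‖1 - Complex.exp z‖⁻¹ * ε ≤ 2 := by
    rw [inv_mul_le_iff₀ (by linarith)]; linarith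
  rw [hankelKernel, norm_mul, norm_div, norm_mul, norm_mul z, hzn, Complex.norm_I, mul_one,
    div_eq_mul_inv]
  calc _ ≤ (Real.exp (|s.im| * Real.pi) * ε ^ (s.re - 1)) * Real.exp ‖a‖
        * (‖1 - Complex.exp z‖⁻¹ * ε) := by
          rw [mul_assoc]; gcongr
    _ ≤ (Real.exp (|s.im| * Real.pi) * ε ^ (s.re - 1)) * Real.exp ‖a‖ * 2 := by gcongr
    _ = _ := by ring

theorem hankelIntegral_eq_ray_sub_ray {s a : ℂ} (hs : 1 < s.re) (ha : 0 < a.re) :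
    hankelIntegral 1 s a = (2 * (Real.pi : ℂ) * Complex.I)⁻¹ *
      ((∫ x in Set.Ioi (0 : ℝ), hankelKernel s a ((Real.log x : ℂ) - Real.pi * Complex.I) (-(x : ℂ)))
        - ∫ x in Set.Ioi (0 : ℝ),
            hankelKernel s a ((Real.log x : ℂ) + Real.pi * Complex.I) (-(x : ℂ))) := by
  have hlim : Filter.Tendsto (fun ε : ℝ => hankelIntegral ε s a) (nhdsWithin 0 (Set.Ioi 0))
      (nhds ((2 * (Real.pi : ℂ) * Complex.I)⁻¹ *
      ((∫ x in Set.Ioi (0 : ℝ), hankelKernel s a ((Real.log x : ℂ) - Real.pi * Complex.I) (-(x : ℂ)))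
        + 0 - ∫ x in Set.Ioi (0 : ℝ),
            hankelKernel s a ((Real.log x : ℂ) + Real.pi * Complex.I) (-(x : ℂ))))) := by
    have hray : ∀ c : ℂ, Filter.Tendsto
        (fun ε : ℝ => ∫ x in Set.Ioi ε, hankelKernel s a ((Real.log x : ℂ) + c) (-(x : ℂ)))
        (nhdsWithin 0 (Set.Ioi 0))
        (nhds (∫ x in Set.Ioi (0 : ℝ), hankelKernel s a ((Real.log x : ℂ) + c) (-(x : ℂ)))) := by
      intro c
      have hi := integrableOn_hankelKernel_ray hs ha c
      have hcont := intervalIntegral.continuousOn_primitive_interval_left (a := 0) (b := 1)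
        (μ := MeasureTheory.volume)
        (f := fun x : ℝ => hankelKernel s a ((Real.log x : ℂ) + c) (-(x : ℂ)))
        (by
          rw [Set.uIcc_of_le zero_le_one, integrableOn_Icc_iff_integrableOn_Ioc]
          exact hi.mono_set Set.Ioc_subset_Ioi_self)
      have h0 := (hcont 0 (by simp)).tendsto.mono_left
        (show nhdsWithin (0 : ℝ) (Set.Ioc 0 1) ≤ _ from
          nhdsWithin_mono _ (by rw [Set.uIcc_of_le zero_le_one]; exact Set.Ioc_subset_Icc_self))
      rw [nhdsWithin_Ioc_eq_nhdsGT (zero_lt_one (α := ℝ))] at h0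
      have h1 := h0.add_const
        (∫ x in Set.Ioi (1 : ℝ), hankelKernel s a ((Real.log x : ℂ) + c) (-(x : ℂ)))
      have hi1 := hi.mono_set (Set.Ioi_subset_Ioi (zero_le_one (α := ℝ)))
      rw [intervalIntegral.integral_interval_add_Ioi hi hi1] at h1
      refine h1.congr' ?_
      filter_upwards [self_mem_nhdsWithin] with ε hε
      exact intervalIntegral.integral_interval_add_Ioi
        (hi.mono_set (Set.Ioi_subset_Ioi (Set.mem_Ioi.1 hε).le)) hi1
    have hcirc : Filter.Tendsto (fun ε : ℝ => ∫ θ in (-Real.pi)..Real.pi,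
          hankelKernel s a ((Real.log ε : ℂ) + θ * Complex.I) (ε * Complex.exp (θ * Complex.I))
            * (ε * Complex.exp (θ * Complex.I) * Complex.I))
        (nhdsWithin 0 (Set.Ioi 0)) (nhds 0) := by
      have h1 : Filter.Tendsto (fun ε : ℝ => Real.exp (|s.im| * Real.pi) * Real.exp ‖a‖ * 2
          * ε ^ (s.re - 1) * |Real.pi - -Real.pi|) (nhdsWithin 0 (Set.Ioi 0)) (nhds 0) := by
        have h2 : Filter.Tendsto (fun ε : ℝ => ε ^ (s.re - 1)) (nhds 0) (nhds 0) := by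
          have := (Real.continuousAt_rpow_const 0 (s.re - 1) (Or.inr (by linarith))).tendsto
          rwa [Real.zero_rpow (by linarith)] at this
        simpa using ((h2.mono_left nhdsWithin_le_nhds).const_mul
          (Real.exp (|s.im| * Real.pi) * Real.exp ‖a‖ * 2)).mul_const |Real.pi - -Real.pi|
      refine squeeze_zero_norm' ?_ h1
      have h3 : Set.Ioc (0 : ℝ) (1 / 2) ∈ nhdsWithin (0 : ℝ) (Set.Ioi 0) :=
        Ioc_mem_nhdsGT (by norm_num)
      filter_upwards [h3] with ε hε
      refine intervalIntegral.norm_integral_le_of_norm_le_const fun θ hθ => ?_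
      rw [Set.uIoc_of_le (by linarith [Real.pi_pos])] at hθ
      exact norm_hankelKernel_circle_le s a hε.1 hε.2 (abs_le.2 ⟨hθ.1.le, hθ.2⟩)
    have hm := hray (-(Real.pi * Complex.I))
    simp only [← sub_eq_add_neg] at hm
    exact ((hm.add hcirc).sub (hray _)).const_mul _
  rw [add_zero] at hlim
  refine tendsto_nhds_unique (tendsto_const_nhds.congr' ?_) hlim
  have h3 : Set.Ioc (0 : ℝ) 1 ∈ nhdsWithin (0 : ℝ) (Set.Ioi 0) := Ioc_mem_nhdsGT one_pos
  filter_upwards [h3] with ε hε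
  exact hankelIntegral_one_eq hε.1 hε.2 hs ha

/-- The integrands on the two sides of the cut differ only by the phases `e ^ (∓πi (s - 1))`, whose
difference is `2i sin (πs)`. -/
theorem hankelIntegral_eq_sin_mul {s a : ℂ} (hs : 1 < s.re) (ha : 0 < a.re) :
    hankelIntegral 1 s a = Complex.sin (Real.pi * s) / Real.pi *
      ∫ x in Set.Ioi (0 : ℝ), hankelKernel s a (Real.log x : ℂ) (-(x : ℂ)) := by
  have h1 : ∀ c : ℂ, (∫ x in Set.Ioi (0 : ℝ), hankelKernel s a ((Real.log x : ℂ) + c) (-(x : ℂ)))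
      = Complex.exp ((s - 1) * c) *
        ∫ x in Set.Ioi (0 : ℝ), hankelKernel s a (Real.log x : ℂ) (-(x : ℂ)) := by
    intro c
    rw [← MeasureTheory.integral_const_mul]
    congr 1
    funext x
    rw [hankelKernel, hankelKernel, mul_add, Complex.exp_add]
    ring
  have h2 := h1 (-(Real.pi * Complex.I))
  simp only [← sub_eq_add_neg] at h2
  rw [hankelIntegral_eq_ray_sub_ray hs ha, h1, h2, ← sub_mul, ← mul_assoc]
  congr 1
  have h3 : Complex.exp ((s - 1) * -(Real.pi * Complex.I))
      = -Complex.exp (-(Real.pi * s) * Complex.I) := by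
    rw [show (s - 1) * -(Real.pi * Complex.I)
      = -(Real.pi * s) * Complex.I + Real.pi * Complex.I by ring, Complex.exp_add,
      Complex.exp_pi_mul_I]
    ring
  have h4 : Complex.exp ((s - 1) * (Real.pi * Complex.I))
      = -Complex.exp ((Real.pi * s) * Complex.I) := by
    rw [show (s - 1) * (Real.pi * Complex.I)
      = (Real.pi * s) * Complex.I - Real.pi * Complex.I by ring, Complex.exp_sub,
      Complex.exp_pi_mul_I]
    ring
  have h5 : (Real.pi : ℂ) ≠ 0 := by exact_mod_cast Real.pi_ne_zero
  rw [h3, h4, Complex.sin]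
  field_simp
  rw [Complex.I_sq]
  ring

/-! ### The Gamma integral and the Hurwitz series -/

/-- Holomorphic functions on the right half-plane that agree on a real interval are equal. -/
theorem eq_of_differentiableOn_of_eq_ofReal {f g : ℂ → ℂ}
    (hf : DifferentiableOn ℂ f {z | 0 < z.re}) (hg : DifferentiableOn ℂ g {z | 0 < z.re})
    (h : ∀ x : ℝ, 1 < x → x < 2 → f x = g x) {z : ℂ} (hz : 0 < z.re) : f z = g z := by
  have hU : IsOpen {z : ℂ | 0 < z.re} := isOpen_lt continuous_const Complex.continuous_re
  refine (hf.analyticOnNhd hU).eqOn_of_preconnected_of_frequently_eq (z₀ := 1)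
    (hg.analyticOnNhd hU) (convex_halfSpace_re_gt 0).isPreconnected (by simp) ?_ hz
  have h1 : Filter.Tendsto (fun x : ℝ => (x : ℂ)) (nhdsWithin 1 (Set.Ioi 1))
      (nhdsWithin 1 {1}ᶜ) := by
    refine tendsto_nhdsWithin_iff.2 ⟨?_, ?_⟩
    · have : Filter.Tendsto (fun x : ℝ => (x : ℂ)) (nhds 1) (nhds ((1 : ℝ) : ℂ)) :=
        Complex.continuous_ofReal.tendsto 1
      rw [Complex.ofReal_one] at this
      exact this.mono_left nhdsWithin_le_nhds
    · filter_upwards [self_mem_nhdsWithin] with x hx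
      simpa using (Set.mem_Ioi.1 hx).ne'
  refine h1.frequently (Filter.Eventually.frequently ?_)
  filter_upwards [Ioo_mem_nhdsGT (show (1 : ℝ) < 2 by norm_num)] with x hx
  exact h x hx.1 hx.2

theorem norm_exp_log_mul_exp {s b : ℂ} {x : ℝ} (hx : 0 < x) :
    ‖Complex.exp ((s - 1) * (Real.log x : ℂ)) * Complex.exp (b * -(x : ℂ))‖
      = x ^ (s.re - 1) * Real.exp (-b.re * x) := by
  rw [norm_mul, Complex.norm_exp, Complex.norm_exp, Real.rpow_def_of_pos hx, Complex.re_mul_ofReal]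
  congr 2
  · simp; ring
  · simp

theorem integrableOn_exp_log_mul_exp {s b : ℂ} (hs : 0 < s.re) (hb : 0 < b.re) :
    MeasureTheory.IntegrableOn (fun x : ℝ => Complex.exp ((s - 1) * (Real.log x : ℂ))
      * Complex.exp (b * -(x : ℂ))) (Set.Ioi 0) := by
  have h1 := integrableOn_rpow_mul_exp_neg_mul_rpow (p := 1) (s := s.re - 1) (by linarith)
    one_pos hb
  simp only [Real.rpow_one] at h1
  refine MeasureTheory.Integrable.mono' h1 (by fun_prop) ?_
  filter_upwards [MeasureTheory.ae_restrict_mem measurableSet_Ioi] with x hx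
  exact (norm_exp_log_mul_exp hx).le

/-- The Gamma integral `∫ x ^ (s - 1) e ^ (-b x) = Γ(s) / b ^ s` for complex `b`. -/
theorem integral_exp_log_mul_exp {s b : ℂ} (hs : 0 < s.re) (hb : 0 < b.re) :
    ∫ x in Set.Ioi (0 : ℝ), Complex.exp ((s - 1) * (Real.log x : ℂ))
      * Complex.exp (b * -(x : ℂ)) = Complex.Gamma s * (1 / b ^ s) := by
  -- Both sides are holomorphic in `b`, so the classical formula for real `b` suffices.
  refine eq_of_differentiableOn_of_eq_ofReal
    (f := fun b => ∫ x in Set.Ioi (0 : ℝ), Complex.exp ((s - 1) * (Real.log x : ℂ))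
      * Complex.exp (b * -(x : ℂ))) (g := fun b => Complex.Gamma s * (1 / b ^ s)) ?_ ?_ ?_ hb
  · intro b hb
    have h := (hasDerivAt_integral_exp_mul (μ := MeasureTheory.volume.restrict (Set.Ioi (0 : ℝ)))
      (e := fun x => -(x : ℂ)) (w := fun x => Complex.exp ((s - 1) * (Real.log x : ℂ)))
      (isOpen_lt continuous_const Complex.continuous_re) (by fun_prop)
      (fun b hb => (integrableOn_exp_log_mul_exp hs hb).congr
        (Filter.Eventually.of_forall fun x => mul_comm _ _)) hb).2
    simp only [mul_comm (Complex.exp (_ * -(_ : ℂ)))] at h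
    exact h.differentiableAt.differentiableWithinAt
  · intro b hb
    have hb0 : b ≠ 0 := fun h => by simp [h] at hb
    refine DifferentiableAt.differentiableWithinAt ?_
    refine DifferentiableAt.const_mul (DifferentiableAt.div (differentiableAt_const _)
      (differentiableAt_id.cpow_const (Or.inl hb)) ?_) _
    simp [Complex.cpow_eq_zero_iff, hb0]
  · intro r hr _
    have hr0 : 0 < r := by linarith
    have h := Complex.integral_cpow_mul_exp_neg_mul_Ioi hs hr0
    have h1 : (1 / (r : ℂ)) ^ s = 1 / (r : ℂ) ^ s := by
      rw [one_div, one_div, Complex.inv_cpow]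
      rw [Complex.arg_ofReal_of_nonneg hr0.le]
      exact Real.pi_ne_zero.symm
    rw [h1, mul_comm] at h
    rw [← h]
    refine MeasureTheory.setIntegral_congr_fun measurableSet_Ioi fun x hx => ?_
    have hx0 : (0 : ℝ) < x := hx
    rw [Complex.cpow_def_of_ne_zero (by exact_mod_cast hx0.ne'), Complex.ofReal_log hx0.le,
      mul_comm (Complex.log _) (s - 1), mul_neg]

theorem summable_one_div_nat_add_cpow {s a : ℂ} (hs : 1 < s.re) (ha : 0 < a.re) :
    Summable (fun n : ℕ => 1 / ((n : ℂ) + a) ^ s) := by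
  refine Summable.of_norm_bounded
    (((Real.summable_one_div_nat_add_rpow a.re s.re).2 hs).mul_left
      (Real.exp (|s.im| * Real.pi))) fun n => ?_
  have hn : (0 : ℝ) ≤ n := n.cast_nonneg
  have h0 : 0 < ((n : ℂ) + a).re := by simp; linarith
  have h1 : (n : ℂ) + a ≠ 0 := fun h => by rw [h] at h0; simp at h0
  have h2 : (n : ℝ) + a.re ≤ ‖(n : ℂ) + a‖ := by
    have := Complex.re_le_norm ((n : ℂ) + a)
    simpa using this
  have h4 : 0 < (n : ℝ) + a.re := by linarith
  rw [norm_div, norm_one, Complex.norm_cpow_of_ne_zero h1, one_div_div, abs_of_pos h4,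
    div_eq_mul_one_div]
  have h3 : Complex.arg (↑n + a) * s.im ≤ |s.im| * Real.pi :=
    calc Complex.arg (↑n + a) * s.im ≤ |Complex.arg (↑n + a) * s.im| := le_abs_self _
      _ = |s.im| * |Complex.arg (↑n + a)| := by rw [abs_mul, mul_comm]
      _ ≤ _ := by gcongr; exact Complex.abs_arg_le_pi _
  exact mul_le_mul (Real.exp_le_exp.2 h3) (one_div_le_one_div_of_le (Real.rpow_pos_of_pos h4 _)
    (Real.rpow_le_rpow h4.le h2 (by linarith))) (by positivity) (Real.exp_pos _).le

/-- Expand `1 / (1 - e ^ (-x))` as a geometric series and integrate termwise. The integrals of the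
norms are summable because `1 < Re s`. -/
theorem integral_hankelKernel_eq_Gamma_mul_tsum {s a : ℂ} (hs : 1 < s.re) (ha : 0 < a.re) :
    ∫ x in Set.Ioi (0 : ℝ), hankelKernel s a (Real.log x : ℂ) (-(x : ℂ))
      = Complex.Gamma s * ∑' n : ℕ, 1 / ((n : ℂ) + a) ^ s := by
  have hs0 : 0 < s.re := by linarith
  have hre : ∀ n : ℕ, 0 < ((n : ℂ) + a).re := fun n => by
    have hn : (0 : ℝ) ≤ n := n.cast_nonneg
    simp; linarith
  have hnorm : ∀ n : ℕ, ∫ x in Set.Ioi (0 : ℝ),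
      ‖Complex.exp ((s - 1) * (Real.log x : ℂ)) * Complex.exp (((n : ℂ) + a) * -(x : ℂ))‖
      = (1 / |(n : ℝ) + a.re| ^ s.re) * Real.Gamma s.re := by
    intro n
    have h1 := Real.integral_rpow_mul_exp_neg_mul_Ioi hs0 (hre n)
    have h2 : ((n : ℂ) + a).re = n + a.re := by simp
    rw [Real.div_rpow zero_le_one (hre n).le, Real.one_rpow, h2] at h1
    rw [abs_of_pos (by rw [← h2]; exact hre n), ← h1]
    refine MeasureTheory.setIntegral_congr_fun measurableSet_Ioi fun x hx => ?_
    rw [norm_exp_log_mul_exp hx, h2, neg_mul]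
  have h := MeasureTheory.hasSum_integral_of_summable_integral_norm
    (μ := MeasureTheory.volume.restrict (Set.Ioi (0 : ℝ)))
    (F := fun (n : ℕ) (x : ℝ) => Complex.exp ((s - 1) * (Real.log x : ℂ))
      * Complex.exp (((n : ℂ) + a) * -(x : ℂ)))
    (fun n => integrableOn_exp_log_mul_exp hs0 (hre n))
    (by
      simp_rw [hnorm]
      exact ((Real.summable_one_div_nat_add_rpow a.re s.re).2 hs).mul_right _)
  rw [← tsum_mul_left]
  simp_rw [integral_exp_log_mul_exp hs0 (hre _)] at h
  rw [h.tsum_eq]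
  refine MeasureTheory.setIntegral_congr_fun measurableSet_Ioi fun x hx => ?_
  have hx0 : (0 : ℝ) < x := hx
  have h3 : ‖Complex.exp (-(x : ℂ))‖ < 1 := by
    rw [Complex.norm_exp]; simpa using hx0
  have h4 := tsum_geometric_of_norm_lt_one h3
  simp only [hankelKernel, div_eq_mul_inv]
  rw [← h4, ← tsum_mul_left]
  refine tsum_congr fun n => ?_
  rw [← Complex.exp_nat_mul, mul_assoc, ← Complex.exp_add]
  congr 2
  ring

theorem hankelIntegral_eq_tsum {s a : ℂ} (hs : 1 < s.re) (ha : 0 < a.re) :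
    hankelIntegral 1 s a = Complex.sin (Real.pi * s) / Real.pi *
      (Complex.Gamma s * ∑' n : ℕ, 1 / ((n : ℂ) + a) ^ s) := by
  rw [hankelIntegral_eq_sin_mul hs ha, integral_hankelKernel_eq_Gamma_mul_tsum hs ha]

/-! ### The derivative of the contour integral at the integers `j + 1 > 1` -/

theorem continuousAt_integral_hankelKernel {s a : ℂ} (hs : 1 < s.re) (ha : 0 < a.re) :
    ContinuousAt (fun s => ∫ x in Set.Ioi (0 : ℝ), hankelKernel s a (Real.log x : ℂ) (-(x : ℂ)))
      s := by
  have h := (hasDerivAt_integral_exp_mul (μ := MeasureTheory.volume.restrict (Set.Ioi (0 : ℝ)))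
      (e := fun x => (Real.log x : ℂ))
      (w := fun x => hankelKernel 1 a (Real.log x : ℂ) (-(x : ℂ)))
      (U := {u | 0 < u.re}) (u := s - 1)
      (isOpen_lt continuous_const Complex.continuous_re) (by fun_prop)
      (fun u hu => by
        have h1 := integrableOn_hankelKernel_ray (s := u + 1) (a := a)
          (by simpa using hu) ha 0
        refine h1.congr (Filter.Eventually.of_forall fun x => ?_)
        simp only [hankelKernel, add_zero, add_sub_cancel_right, sub_self, zero_mul,
          Complex.exp_zero, one_mul, mul_div_assoc]) (by simpa using hs)).2
  refine ((h.comp_sub_const s 1).continuousAt).congr (Filter.Eventually.of_forall fun t => ?_)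
  refine MeasureTheory.integral_congr_ae (Filter.Eventually.of_forall fun x => ?_)
  simp only [hankelKernel, sub_self, zero_mul, Complex.exp_zero, one_mul, mul_div_assoc]

/-- At an integer `j + 1 > 1` the derivative of the contour integral is a multiple of
`ζ(j + 1, a)`. -/
theorem deriv_hankelIntegral_nat {j : ℕ} (hj : 1 ≤ j) {a : ℂ} (ha : 0 < a.re) :
    deriv (fun s => hankelIntegral 1 s a) ((j : ℂ) + 1)
      = (-1) ^ (j + 1) * j.factorial * hurwitzZetaC ((j : ℂ) + 1) a := by
  have hs : 1 < ((j : ℂ) + 1).re := by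
    have : (1 : ℝ) ≤ j := by exact_mod_cast hj
    simp; linarith
  have hpi : (Real.pi : ℂ) ≠ 0 := by exact_mod_cast Real.pi_ne_zero
  have hang : (Real.pi : ℂ) * ((j : ℂ) + 1) = ((j + 1 : ℕ) : ℂ) * Real.pi := by
    push_cast; ring
  have hsin : HasDerivAt (fun s : ℂ => Complex.sin (Real.pi * s) / Real.pi)
      ((-1) ^ (j + 1)) ((j : ℂ) + 1) := by
    have h1 : HasDerivAt (fun s : ℂ => (Real.pi : ℂ) * s) Real.pi ((j : ℂ) + 1) := by
      simpa using (hasDerivAt_id ((j : ℂ) + 1)).const_mul (Real.pi : ℂ)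
    refine (h1.csin.div_const (Real.pi : ℂ)).congr_deriv ?_
    have h2 : Complex.cos (((j + 1 : ℕ) : ℂ) * Real.pi) = (-1) ^ (j + 1) := by
      exact_mod_cast congrArg (fun x : ℝ => (x : ℂ)) (Real.cos_nat_mul_pi (j + 1))
    rw [hang, h2]
    field_simp
  have h0 : Complex.sin (Real.pi * ((j : ℂ) + 1)) / Real.pi = 0 := by
    rw [hang, Complex.sin_nat_mul_pi, zero_div]
  have hM := continuousAt_integral_hankelKernel hs ha
  have hprod : HasDerivAt (fun s : ℂ => Complex.sin (Real.pi * s) / Real.pi *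
      ∫ x in Set.Ioi (0 : ℝ), hankelKernel s a (Real.log x : ℂ) (-(x : ℂ)))
      ((-1) ^ (j + 1) * ∫ x in Set.Ioi (0 : ℝ),
        hankelKernel ((j : ℂ) + 1) a (Real.log x : ℂ) (-(x : ℂ))) ((j : ℂ) + 1) := by
    -- The sine vanishes at `j + 1`, so the slope of the product is the slope of the sine factor
    -- times the integral, and continuity of the integral is enough.
    rw [hasDerivAt_iff_tendsto_slope] at hsin ⊢
    refine (hsin.mul (hM.tendsto.mono_left nhdsWithin_le_nhds)).congr fun t => ?_
    simp only [slope_def_field, h0, zero_mul, sub_zero]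
    ring
  have hev : (fun s => hankelIntegral 1 s a) =ᶠ[nhds ((j : ℂ) + 1)] fun s =>
      Complex.sin (Real.pi * s) / Real.pi *
      ∫ x in Set.Ioi (0 : ℝ), hankelKernel s a (Real.log x : ℂ) (-(x : ℂ)) := by
    filter_upwards [(isOpen_lt continuous_const Complex.continuous_re).mem_nhds hs] with t ht
    exact hankelIntegral_eq_sin_mul ht ha
  rw [hev.deriv_eq, hprod.deriv, integral_hankelKernel_eq_Gamma_mul_tsum hs ha, hurwitzZetaC,
    if_pos hs, Complex.Gamma_nat_eq_factorial, mul_assoc]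

/-! ### The derivative at `s = 1` is `ψ(a) + γ` -/

theorem inv_Gamma_one_sub_eq {s : ℂ} (hs : 0 < s.re) :
    (Complex.Gamma (1 - s))⁻¹ = Complex.sin (Real.pi * s) / Real.pi * Complex.Gamma s := by
  have h0 := Complex.Gamma_ne_zero_of_re_pos hs
  have h1 := Complex.Gamma_mul_Gamma_one_sub s
  rw [← inv_inj, inv_inv, mul_inv, inv_div, ← h1, mul_comm (Complex.Gamma s), mul_assoc,
    mul_inv_cancel₀ h0, mul_one]

/-- For `1 < Re s`, `I(s)` is the Hurwitz series divided by `Γ(1 - s)`. -/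
theorem hankelIntegral_eq_inv_Gamma_mul_tsum {s a : ℂ} (hs : 1 < s.re) (ha : 0 < a.re) :
    hankelIntegral 1 s a = (1 - s) * (Complex.Gamma (2 - s))⁻¹ *
      ∑' n : ℕ, 1 / ((n : ℂ) + a) ^ s := by
  -- Writing `1 / Γ(1 - s)` as `(1 - s) / Γ(2 - s)` isolates the zero that cancels the pole of the
  -- series at `s = 1`.
  rw [hankelIntegral_eq_tsum hs ha, ← mul_assoc, ← inv_Gamma_one_sub_eq (by linarith),
    Complex.one_div_Gamma_eq_self_mul_one_div_Gamma_add_one (1 - s)]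
  congr 4
  ring

/-- The derivatives at `c` of two functions that agree to the right of `c` are equal. -/
theorem hasDerivAt_unique_of_eq_of_re_lt {f g : ℂ → ℂ} {f' g' c : ℂ} (hf : HasDerivAt f f' c)
    (hg : HasDerivAt g g' c) (h : ∀ s : ℂ, c.re < s.re → f s = g s) : f' = g' := by
  have hl0 : Filter.Tendsto (fun x : ℝ => c + (x : ℂ)) (nhdsWithin 0 (Set.Ioi 0)) (nhds c) := by
    have h1 : Continuous (fun x : ℝ => c + (x : ℂ)) := by fun_prop
    have h2 := h1.tendsto 0
    simp only [Complex.ofReal_zero, add_zero] at h2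
    exact h2.mono_left nhdsWithin_le_nhds
  have hl : Filter.Tendsto (fun x : ℝ => c + (x : ℂ)) (nhdsWithin 0 (Set.Ioi 0))
      (nhdsWithin c {c}ᶜ) := by
    refine tendsto_nhdsWithin_iff.2 ⟨hl0, ?_⟩
    filter_upwards [self_mem_nhdsWithin] with x hx
    simpa using (Set.mem_Ioi.1 hx).ne'
  have hEq : ∀ᶠ x : ℝ in nhdsWithin 0 (Set.Ioi 0), f (c + x) = g (c + x) := by
    filter_upwards [self_mem_nhdsWithin] with x hx
    exact h _ (by simpa using hx)
  have hc : f c = g c := tendsto_nhds_unique_of_eventuallyEq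
    (hf.continuousAt.tendsto.comp hl0) (hg.continuousAt.tendsto.comp hl0) hEq
  rw [hasDerivAt_iff_tendsto_slope] at hf hg
  refine tendsto_nhds_unique_of_eventuallyEq (hf.comp hl) (hg.comp hl) ?_
  filter_upwards [hEq] with x hx
  simp only [Function.comp_apply, slope_def_field, hx, hc]

theorem hasDerivAt_inv_Gamma_two_sub_one :
    HasDerivAt (fun s : ℂ => (Complex.Gamma (2 - s))⁻¹) (-(Real.eulerMascheroniConstant : ℂ)) 1 := by
  have h1 : HasDerivAt (fun s : ℂ => 2 - s) (-1) 1 := by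
    simpa using (hasDerivAt_id (1 : ℂ)).const_sub 2
  have h2 : HasDerivAt Complex.Gamma (-(Real.eulerMascheroniConstant : ℂ)) (2 - 1) := by
    rw [show (2 : ℂ) - 1 = 1 by norm_num]; exact Complex.hasDerivAt_Gamma_one
  have h3 := (h2.comp (1 : ℂ) h1).inv (by
    simp only [Function.comp_apply]
    rw [show (2 : ℂ) - 1 = 1 by norm_num, Complex.Gamma_one]; exact one_ne_zero)
  refine h3.congr_deriv ?_
  simp only [Function.comp_apply]
  rw [show (2 : ℂ) - 1 = 1 by norm_num, Complex.Gamma_one]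
  ring

/-- For `a = 1` the series is the Riemann zeta function, and `(s - 1) ζ(s) = 1 + γ (s - 1) + …`
while `1 / Γ(2 - s) = 1 - γ (s - 1) + …`, so the linear terms cancel in the product. -/
theorem deriv_hankelIntegral_one_one : deriv (fun s => hankelIntegral 1 s 1) 1 = 0 := by
  set R : ℂ → ℂ := Function.update (fun s => (s - 1) * riemannZeta s) 1 1 with hR
  have hRd : HasDerivAt R (Real.eulerMascheroniConstant : ℂ) 1 := by
    rw [hasDerivAt_iff_tendsto_slope]
    refine tendsto_riemannZeta_sub_one_div.congr' ?_
    filter_upwards [self_mem_nhdsWithin] with s hs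
    have hs1 : s ≠ 1 := hs
    have hs0 : s - 1 ≠ 0 := sub_ne_zero.2 hs1
    rw [slope_def_field, hR, Function.update_self, Function.update_of_ne hs1]
    field_simp
  have hprod := (hasDerivAt_inv_Gamma_two_sub_one.mul hRd).neg
  have h1 : R 1 = 1 := by rw [hR, Function.update_self]
  refine (hasDerivAt_unique_of_eq_of_re_lt
    (hankelIntegral_differentiable 1 (by simp) 1).hasDerivAt hprod fun s hs => ?_).trans ?_
  · rw [Complex.one_re] at hs
    have hs1 : s ≠ 1 := fun h => by rw [h] at hs; simp at hs
    simp only [hankelIntegral_eq_inv_Gamma_mul_tsum hs (show 0 < (1 : ℂ).re by simp),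
      ← zeta_eq_tsum_one_div_nat_add_one_cpow hs, Pi.neg_apply, Pi.mul_apply, hR,
      Function.update_of_ne hs1]
    ring
  · rw [h1, show (2 : ℂ) - 1 = 1 by norm_num, Complex.Gamma_one]
    ring

/-- The two Hurwitz series differ by the term `a ^ (-s)`, so for `1 < Re s` the contour integrals
differ by `(s - 1) a ^ (-s) / Γ(2 - s)`. The derivative of this at the boundary point `s = 1` is `1
/ a`. -/
theorem deriv_hankelIntegral_one_add_one {a : ℂ} (ha : 0 < a.re) :
    deriv (fun s => hankelIntegral 1 s (a + 1)) 1
      = deriv (fun s => hankelIntegral 1 s a) 1 + a⁻¹ := by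
  have ha1 : 0 < (a + 1).re := by simp; linarith
  have ha0 : a ≠ 0 := fun h => by simp [h] at ha
  have hL := (hankelIntegral_differentiable (a + 1) ha1 1).hasDerivAt.sub
    (hankelIntegral_differentiable a ha 1).hasDerivAt
  have hp : HasDerivAt (fun s : ℂ => s - 1) 1 1 := (hasDerivAt_id (1 : ℂ)).sub_const 1
  have hpow : DifferentiableAt ℂ (fun s : ℂ => (a ^ s)⁻¹) 1 :=
    ((differentiableAt_id).const_cpow (Or.inl ha0)).inv (by simp [ha0])
  have hR := hp.mul (hasDerivAt_inv_Gamma_two_sub_one.mul hpow.hasDerivAt)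
  have h := hasDerivAt_unique_of_eq_of_re_lt hL hR fun s hs => by
    rw [Complex.one_re] at hs
    simp only [Pi.sub_apply, Pi.mul_apply, hankelIntegral_eq_inv_Gamma_mul_tsum hs ha,
      hankelIntegral_eq_inv_Gamma_mul_tsum hs ha1]
    rw [(summable_one_div_nat_add_cpow hs ha).tsum_eq_zero_add]
    have h1 : ∀ n : ℕ, ((n + 1 : ℕ) : ℂ) + a = n + (a + 1) := fun n => by push_cast; ring
    simp_rw [h1]
    simp only [Nat.cast_zero, zero_add, one_div]
    ring
  rw [← sub_eq_iff_eq_add', h]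
  simp [show (2 : ℂ) - 1 = 1 by norm_num]

theorem norm_hurwitzZetaC_two_le (n : ℕ) {b : ℂ} (hb : (n : ℝ) + 1 ≤ b.re) :
    ‖hurwitzZetaC 2 b‖ ≤ ∑' m : ℕ, 1 / (((m + n : ℕ) : ℝ) + 1) ^ 2 := by
  have hS : Summable (fun m : ℕ => 1 / (((m + n : ℕ) : ℝ) + 1) ^ 2) := by
    have h := (summable_nat_add_iff (n + 1)).2 (Real.summable_one_div_nat_pow.2 one_lt_two)
    refine h.congr fun m => ?_
    push_cast
    ring_nf
  rw [hurwitzZetaC, if_pos (by simp)]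
  refine tsum_of_norm_bounded hS.hasSum fun m => ?_
  have h1 : ((m + n : ℕ) : ℝ) + 1 ≤ ‖(m : ℂ) + b‖ := by
    have := Complex.re_le_norm ((m : ℂ) + b)
    simp at this ⊢
    linarith
  rw [Complex.cpow_ofNat, norm_div, norm_one, norm_pow]
  gcongr

/-- The `a`-derivative of `J(1, a)` is `J(2, a) = ζ(2, a)`. On the half-plane `Re a ≥ n + 1` this is
bounded by a tail of `∑ 1 / m ^ 2`, and the mean value inequality applies. -/
theorem norm_deriv_hankelIntegral_sub_le (n : ℕ) {x : ℝ} (hx1 : 1 ≤ x) (hx2 : x ≤ 2) :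
    ‖deriv (fun s => hankelIntegral 1 s ((x : ℂ) + n)) 1
      - deriv (fun s => hankelIntegral 1 s ((1 : ℂ) + n)) 1‖
      ≤ ∑' m : ℕ, 1 / (((m + n : ℕ) : ℝ) + 1) ^ 2 := by
  have hS0 : 0 ≤ ∑' m : ℕ, 1 / (((m + n : ℕ) : ℝ) + 1) ^ 2 :=
    tsum_nonneg fun m => by positivity
  have hn : (0 : ℝ) ≤ n := n.cast_nonneg
  have h := Convex.norm_image_sub_le_of_norm_hasDerivWithin_le
    (f := fun a => deriv (fun s => hankelIntegral 1 s a) 1) (f' := fun a => hurwitzZetaC 2 a)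
    (s := {b : ℂ | (n : ℝ) + 1 ≤ b.re}) (x := (1 : ℂ) + n) (y := (x : ℂ) + n)
    (C := ∑' m : ℕ, 1 / (((m + n : ℕ) : ℝ) + 1) ^ 2)
    (fun b hb => by
      have hb' : (n : ℝ) + 1 ≤ b.re := hb
      have hb0 : 0 < b.re := by linarith
      have h1 := hasDerivAt_deriv_hankelIntegral 1 hb0
      have h2 := deriv_hankelIntegral_nat (le_refl 1) hb0
      rw [Nat.cast_one] at h2
      rw [h2] at h1
      refine (h1.congr_deriv ?_).hasDerivWithinAt
      norm_num)
    (fun b hb => norm_hurwitzZetaC_two_le n hb) (convex_halfSpace_re_ge _)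
    (by simp; linarith) (by simp; linarith)
  refine h.trans ?_
  have h3 : ‖(x : ℂ) + n - (1 + n)‖ ≤ 1 := by
    rw [show (x : ℂ) + n - (1 + n) = ((x - 1 : ℝ) : ℂ) by push_cast; ring, Complex.norm_real,
      Real.norm_eq_abs, abs_le]
    constructor <;> linarith
  exact mul_le_of_le_one_right hS0 h3

theorem digamma_ofReal {x : ℝ} (hx : 0 < x) :
    Complex.digamma x = (deriv (Real.log ∘ Real.Gamma) x : ℝ) := by
  have hne : ∀ m : ℕ, x ≠ -m := fun m h => by
    have : (0 : ℝ) ≤ m := m.cast_nonneg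
    linarith
  have hr := (Real.differentiableAt_Gamma hne).hasDerivAt
  have hc := (Complex.differentiableAt_Gamma (x : ℂ) fun m h => hne m (by exact_mod_cast h)).hasDerivAt
  have h1 := hc.comp_ofReal
  have h2 := hr.ofReal_comp
  simp only [Complex.Gamma_ofReal] at h1
  have h3 := h1.unique h2
  have h4 : deriv (Real.log ∘ Real.Gamma) x = deriv Real.Gamma x / Real.Gamma x :=
    (hr.log (Real.Gamma_pos_of_pos hx).ne').deriv
  rw [Complex.digamma_def, logDeriv_apply, h3, Complex.Gamma_ofReal, h4]
  push_cast
  rfl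

/-- Log-convexity of Gamma makes `ψ` increasing on the positive reals, so the increment lies between
`0` and `ψ(n + 2) - ψ(n + 1) = 1 / (n + 1)`. -/
theorem norm_digamma_sub_le (n : ℕ) {x : ℝ} (hx1 : 1 ≤ x) (hx2 : x ≤ 2) :
    ‖Complex.digamma ((x : ℂ) + n) - Complex.digamma ((1 : ℂ) + n)‖ ≤ 1 / ((n : ℝ) + 1) := by
  have hn : (0 : ℝ) ≤ n := n.cast_nonneg
  have hmono : MonotoneOn (deriv (Real.log ∘ Real.Gamma)) (Set.Ioi 0) := by
    refine Real.convexOn_log_Gamma.monotoneOn_deriv fun y hy => ?_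
    have hy0 : (0 : ℝ) < y := hy
    refine (Real.differentiableAt_Gamma fun m h => ?_).log (Real.Gamma_pos_of_pos hy0).ne'
    have : (0 : ℝ) ≤ m := m.cast_nonneg
    linarith
  have h1 := hmono (a := 1 + n) (b := x + n) (by simp; linarith) (by simp; linarith) (by linarith)
  have h2 := hmono (a := x + n) (b := 1 + n + 1) (by simp; linarith) (by simp; linarith)
    (by linarith)
  have h3 : deriv (Real.log ∘ Real.Gamma) (1 + n + 1)
      = deriv (Real.log ∘ Real.Gamma) (1 + n) + ((1 : ℝ) + n)⁻¹ := by
    have h4 := Complex.digamma_apply_add_one ((1 + n : ℝ) : ℂ) fun m h => by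
      have h5 : (1 + n : ℝ) = -m := by exact_mod_cast h
      have : (0 : ℝ) ≤ m := m.cast_nonneg
      linarith
    rw [← Complex.ofReal_one, ← Complex.ofReal_add, digamma_ofReal (by linarith),
      digamma_ofReal (by linarith)] at h4
    exact_mod_cast h4
  have e1 : (x : ℂ) + n = ((x + n : ℝ) : ℂ) := by push_cast; rfl
  have e2 : (1 : ℂ) + n = ((1 + n : ℝ) : ℂ) := by push_cast; rfl
  rw [e1, e2, digamma_ofReal (by linarith), digamma_ofReal (by linarith), ← Complex.ofReal_sub,
    Complex.norm_real, Real.norm_of_nonneg (by linarith), one_div, add_comm (n : ℝ) 1]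
  linarith

/-- The difference `E = J(1, ·) - ψ` has period `1`, because both terms gain `1 / a` under `a ↦ a +
1`. Hence `E x - E 1 = E (x + n) - E (1 + n)`, which tends to `0` for `x` in `(1, 2)`. So `E = E 1 =
γ` there, and the identity theorem extends this to the half-plane. -/
theorem deriv_hankelIntegral_one_eq_digamma {a : ℂ} (ha : 0 < a.re) :
    deriv (fun s => hankelIntegral 1 s a) 1
      = Complex.digamma a + (Real.eulerMascheroniConstant : ℂ) := by
  set E : ℂ → ℂ := fun a => deriv (fun s => hankelIntegral 1 s a) 1 - Complex.digamma a with hE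
  have hne : ∀ {z : ℂ}, 0 < z.re → ∀ m : ℕ, z ≠ -m := fun hz m h => by
    have h1 := congrArg Complex.re h
    have : (0 : ℝ) ≤ m := m.cast_nonneg
    simp at h1
    linarith
  have hper : ∀ (n : ℕ) {z : ℂ}, 0 < z.re → E (z + n) = E z := by
    intro n z hz
    induction n with
    | zero => simp
    | succ n ih =>
      have hn : (0 : ℝ) ≤ n := n.cast_nonneg
      have hzn : 0 < (z + n).re := by simp; linarith
      rw [← ih]
      simp only [hE, Nat.cast_add, Nat.cast_one, ← add_assoc]
      rw [deriv_hankelIntegral_one_add_one hzn, Complex.digamma_apply_add_one _ (hne hzn)]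
      ring
  have hE1 : E 1 = (Real.eulerMascheroniConstant : ℂ) := by
    simp only [hE, deriv_hankelIntegral_one_one, Complex.digamma_one]
    ring
  have hU : IsOpen {z : ℂ | 0 < z.re} := isOpen_lt continuous_const Complex.continuous_re
  have hmain := eq_of_differentiableOn_of_eq_ofReal
    (f := fun a => deriv (fun s => hankelIntegral 1 s a) 1)
    (g := fun a => Complex.digamma a + (Real.eulerMascheroniConstant : ℂ))
    (fun z hz => (hasDerivAt_deriv_hankelIntegral 1 hz).differentiableAt.differentiableWithinAt)
    (by
      have hG : DifferentiableOn ℂ Complex.Gamma {z | 0 < z.re} := fun z hz =>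
        (Complex.differentiableAt_Gamma z (hne hz)).differentiableWithinAt
      exact ((hG.deriv hU).div hG fun z hz => Complex.Gamma_ne_zero_of_re_pos hz).add_const _)
    (fun x hx1 hx2 => by
      have hx0 : 0 < (x : ℂ).re := by simp; linarith
      suffices h : E x - E 1 = 0 by
        rw [hE1, sub_eq_zero] at h
        simp only [hE] at h
        rw [← h]; ring
      have hb : ∀ n : ℕ, ‖E x - E 1‖
          ≤ 1 / ((n : ℝ) + 1) + ∑' m : ℕ, 1 / (((m + n : ℕ) : ℝ) + 1) ^ 2 := by
        intro n
        rw [← hper n hx0, ← hper n (z := 1) (by simp)]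
        have h1 := norm_deriv_hankelIntegral_sub_le n hx1.le hx2.le
        have h2 := norm_digamma_sub_le n hx1.le hx2.le
        simp only [hE]
        rw [sub_sub_sub_comm]
        refine (norm_sub_le _ _).trans ?_
        linarith
      have hlim := tendsto_one_div_add_atTop_nhds_zero_nat (𝕜 := ℝ) |>.add
        (tendsto_sum_nat_add (fun m : ℕ => 1 / ((m : ℝ) + 1) ^ 2))
      rw [add_zero] at hlim
      exact norm_le_zero_iff.1 (ge_of_tendsto' hlim hb)) ha
  exact hmain

/-! ### Taylor expansion in `t` and the final identity -/

theorem iteratedDeriv_deriv_hankelIntegral (j : ℕ) {a : ℂ} (ha : 0 < a.re) :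
    iteratedDeriv j (fun a => deriv (fun s => hankelIntegral 1 s a) 1) a
      = deriv (fun s => hankelIntegral 1 s a) ((j : ℂ) + 1) := by
  induction j generalizing a with
  | zero => simp
  | succ j ih =>
    have hev : iteratedDeriv j (fun a => deriv (fun s => hankelIntegral 1 s a) 1) =ᶠ[nhds a]
        fun a => deriv (fun s => hankelIntegral 1 s a) ((j : ℂ) + 1) := by
      filter_upwards [(isOpen_lt continuous_const Complex.continuous_re).mem_nhds ha] with b hb
      exact ih hb
    rw [iteratedDeriv_succ, hev.deriv_eq, (hasDerivAt_deriv_hankelIntegral _ ha).deriv]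
    push_cast
    rfl

/-- The Taylor expansion of the digamma function. -/
theorem hasSum_hurwitzZetaC_mul_pow {a t : ℂ} (ha : 0 < a.re) (ht : ‖t‖ < a.re) :
    HasSum (fun n : ℕ => hurwitzZetaC (((n + 1 : ℕ) : ℂ) + 1) a * t ^ (n + 1))
      (deriv (fun s => hankelIntegral 1 s a) 1 - deriv (fun s => hankelIntegral 1 s (a - t)) 1) := by
  have hball : ∀ z ∈ Metric.ball a a.re, 0 < z.re := by
    intro z hz
    rw [Metric.mem_ball, dist_comm, dist_eq_norm] at hz
    have h1 := (Complex.re_le_norm (a - z)).trans_lt hz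
    simp at h1
    linarith
  have h := Complex.hasSum_taylorSeries_on_ball (c := a) (r := a.re) (z := a - t)
    (f := fun a => deriv (fun s => hankelIntegral 1 s a) 1)
    (fun z hz => (hasDerivAt_deriv_hankelIntegral 1
      (hball z hz)).differentiableAt.differentiableWithinAt)
    (by simpa [Metric.mem_ball, dist_eq_norm] using ht)
  -- The constant Taylor term moves to the other side. In degree `j = n + 1` the signs `(-1) ^ (j +
  -- 1)` of the coefficient, `(-1) ^ j` of `(-t) ^ j` and `-1` of this negation multiply to `1`.
  have h1 := ((hasSum_nat_add_iff' 1).2 h).neg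
  simp only [Finset.range_one, Finset.sum_singleton, Nat.factorial_zero, Nat.cast_one, inv_one,
    pow_zero, iteratedDeriv_zero, one_smul, neg_sub] at h1
  refine h1.congr_fun fun n => ?_
  rw [iteratedDeriv_deriv_hankelIntegral _ ha, deriv_hankelIntegral_nat (by omega) ha,
    sub_sub_cancel_left, neg_pow, smul_eq_mul, smul_eq_mul]
  have hf : ((n + 1).factorial : ℂ) ≠ 0 := by exact_mod_cast (n + 1).factorial_ne_zero
  have hsq : ((-1 : ℂ) ^ (n + 1)) * (-1) ^ (n + 1) = 1 := by rw [← mul_pow]; simp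
  rw [pow_succ (-1 : ℂ) (n + 1)]
  field_simp
  linear_combination (-(t ^ (n + 1) * hurwitzZetaC (((n + 1 : ℕ) : ℂ) + 1) a)) * hsq

/-- The derivative telescopes: by `(k + 1) C(q, k + 1) = (q - k) C(q, k)`, differentiating `g(k + 1,
a - y)` in one term cancels differentiating the power of `y` in the preceding one. Only the
derivative of `g(0, a - y)` survives. -/
theorem hasDerivAt_sum_choose_mul_gFun (q : ℕ) {a y : ℂ} (hy : 0 < (a - y).re) :
    HasDerivAt
      (fun y => ∑ k ∈ Finset.range (q + 1), (q.choose k : ℂ) * gFun k (a - y) * y ^ (q - k))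
      (-(y ^ q * deriv (fun s => hankelIntegral 1 s (a - y)) 1)) y := by
  have hsub : HasDerivAt (fun y : ℂ => a - y) (-1) y := by
    simpa using (hasDerivAt_id y).const_sub a
  have h0 : HasDerivAt (fun y => gFun 0 (a - y))
      (-deriv (fun s => hankelIntegral 1 s (a - y)) 1) y :=
    ((hasDerivAt_gFun_zero hy).comp y hsub).congr_deriv (by ring)
  have hk : ∀ k : ℕ, HasDerivAt (fun y => gFun (k + 1) (a - y))
      (-((k + 1 : ℕ) * gFun k (a - y))) y := fun k =>
    ((hasDerivAt_gFun_succ k hy).comp y hsub).congr_deriv (by ring)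
  have hsum := HasDerivAt.fun_sum (u := Finset.range q)
    (A := fun k y => (q.choose (k + 1) : ℂ) * gFun (k + 1) (a - y) * y ^ (q - (k + 1)))
    (fun k _ => ((hk k).const_mul (q.choose (k + 1) : ℂ)).fun_mul
      (hasDerivAt_pow (q - (k + 1)) y))
  have hall := hsum.fun_add ((h0.const_mul (q.choose 0 : ℂ)).fun_mul (hasDerivAt_pow (q - 0) y))
  simp_rw [Finset.sum_range_succ' _ q]
  refine hall.congr_deriv ?_
  have hA : ∑ k ∈ Finset.range q, (q.choose (k + 1) : ℂ) * gFun (k + 1) (a - y)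
        * ((q - (k + 1) : ℕ) * y ^ (q - (k + 1) - 1))
      + q.choose 0 * gFun 0 (a - y) * ((q - 0 : ℕ) * y ^ (q - 0 - 1))
      = ∑ k ∈ Finset.range q, (q.choose (k + 1) : ℂ) * ((k + 1 : ℕ) * gFun k (a - y))
        * y ^ (q - (k + 1)) := by
    -- The term `k = q` carries the factor `q - k = 0`, so the truncated exponent `q - k - 1` is
    -- harmless there.
    rw [← Finset.sum_range_succ' (fun k => (q.choose k : ℂ) * gFun k (a - y)
      * ((q - k : ℕ) * y ^ (q - k - 1))) q, Finset.sum_range_succ]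
    simp only [Nat.sub_self, Nat.cast_zero, zero_mul, mul_zero, add_zero]
    refine Finset.sum_congr rfl fun k _ => ?_
    have h1 : (q.choose (k + 1) : ℂ) * (k + 1 : ℕ) = q.choose k * (q - k : ℕ) := by
      exact_mod_cast Nat.choose_succ_right_eq q k
    rw [Nat.sub_sub]
    linear_combination (-(gFun k (a - y) * y ^ (q - (k + 1)))) * h1
  rw [Finset.sum_add_distrib]
  simp only [mul_neg, neg_mul, Finset.sum_neg_distrib, Nat.choose_zero_right, Nat.cast_one,
    one_mul, Nat.sub_zero] at hA ⊢
  linear_combination hA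

/-- The index `n` stands for `n + 1` in the series from `1`. In `ℂ`, `HasSum` entails absolute
convergence. -/
theorem theorem1 (p : ℕ) (hp : 1 ≤ p) (a t : ℂ) (ha : 0 < a.re) (ht : ‖t‖ < a.re) :
    HasSum
      (fun n : ℕ => hurwitzZetaC (((n + 1 : ℕ) : ℂ) + 1) a * t ^ ((n + 1) + p)
        / ((((n + 1) + p : ℕ)) : ℂ))
      (t ^ p / (p : ℂ) * (Complex.digamma a + (Real.eulerMascheroniConstant : ℂ))
        + ∑ k ∈ Finset.range p, ((p - 1).choose k : ℂ) * gFun k (a - t) * t ^ (p - 1 - k)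
        - gFun (p - 1) a) := by
  obtain ⟨q, rfl⟩ : ∃ q, p = q + 1 := ⟨p - 1, by omega⟩
  simp only [Nat.add_sub_cancel]
  -- On the disc of radius `r` the differentiated series is dominated by its value at `r`, where it
  -- converges absolutely because `r < Re a`.
  obtain ⟨r, htr, hra⟩ := exists_between ht
  have hr0 : 0 < r := (norm_nonneg t).trans_lt htr
  set S : ℕ → ℂ → ℂ := fun n y => hurwitzZetaC (((n + 1 : ℕ) : ℂ) + 1) a
    * y ^ ((n + 1) + (q + 1)) / ((((n + 1) + (q + 1) : ℕ)) : ℂ) with hS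
  set S' : ℕ → ℂ → ℂ := fun n y => y ^ q *
    (hurwitzZetaC (((n + 1 : ℕ) : ℂ) + 1) a * y ^ (n + 1)) with hS'
  set F : ℂ → ℂ := fun y =>
    y ^ (q + 1) / ((q + 1 : ℕ) : ℂ) * (Complex.digamma a + (Real.eulerMascheroniConstant : ℂ))
      + ∑ k ∈ Finset.range (q + 1), (q.choose k : ℂ) * gFun k (a - y) * y ^ (q - k)
      - gFun q a with hF
  have hSd : ∀ n y, HasDerivAt (S n) (S' n y) y := by
    intro n y
    have hne : (((n + 1) + (q + 1) : ℕ) : ℂ) ≠ 0 := by exact_mod_cast (n + 1 + q).succ_ne_zero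
    refine (((hasDerivAt_pow ((n + 1) + (q + 1)) y).const_mul
      (hurwitzZetaC (((n + 1 : ℕ) : ℂ) + 1) a)).div_const _).congr_deriv ?_
    simp only [hS']
    rw [show n + 1 + (q + 1) - 1 = q + (n + 1) by omega, pow_add]
    field_simp
  have hu : Summable fun n => ‖S' n r‖ := by
    have h1 := (hasSum_hurwitzZetaC_mul_pow ha (t := (r : ℂ)) (by
      rwa [Complex.norm_real, Real.norm_of_nonneg hr0.le])).summable.norm
    simp only [hS', norm_mul]
    simpa only [norm_mul] using h1.mul_left ‖(r : ℂ) ^ q‖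
  have hbound : ∀ n, ∀ y ∈ Metric.ball (0 : ℂ) r, ‖S' n y‖ ≤ ‖S' n r‖ := by
    intro n y hy
    have hy' : ‖y‖ ≤ ‖(r : ℂ)‖ := by
      rw [Complex.norm_real, Real.norm_of_nonneg hr0.le]
      exact (mem_ball_zero_iff.1 hy).le
    simp only [hS', norm_mul, norm_pow]
    gcongr
  have hpre : IsPreconnected (Metric.ball (0 : ℂ) r) := (convex_ball 0 r).isPreconnected
  have h0mem : (0 : ℂ) ∈ Metric.ball (0 : ℂ) r := Metric.mem_ball_self hr0
  have htmem : t ∈ Metric.ball (0 : ℂ) r := mem_ball_zero_iff.2 htr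
  have hS0 : ∀ n, S n 0 = 0 := fun n => by simp [hS]
  have hS0s : Summable fun n => S n 0 := by simp only [hS0]; exact summable_zero
  have hsum : Summable fun n => S n t :=
    summable_of_summable_hasDerivAt_of_isPreconnected hu Metric.isOpen_ball hpre
      (fun n y _ => hSd n y) hbound h0mem hS0s htmem
  have hy_re : ∀ y ∈ Metric.ball (0 : ℂ) r, ‖y‖ < a.re ∧ 0 < (a - y).re := by
    intro y hy
    have h1 : ‖y‖ < a.re := (mem_ball_zero_iff.1 hy).trans hra
    refine ⟨h1, ?_⟩
    have := Complex.re_le_norm y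
    simp
    linarith
  have hFd : ∀ y ∈ Metric.ball (0 : ℂ) r, HasDerivAt (fun z => (∑' n, S n z) - F z) 0 y := by
    intro y hy
    obtain ⟨hya, hyr⟩ := hy_re y hy
    have h1 := hasDerivAt_tsum_of_isPreconnected hu Metric.isOpen_ball hpre
      (fun n y _ => hSd n y) hbound h0mem hS0s hy
    have h2 := ((((hasDerivAt_pow (q + 1) y).div_const ((q + 1 : ℕ) : ℂ)).mul_const
      (Complex.digamma a + (Real.eulerMascheroniConstant : ℂ))).fun_add
      (hasDerivAt_sum_choose_mul_gFun q hyr)).sub_const (gFun q a)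
    refine (h1.fun_sub h2).congr_deriv ?_
    have hne : ((q + 1 : ℕ) : ℂ) ≠ 0 := by exact_mod_cast q.succ_ne_zero
    simp only [hS']
    rw [tsum_mul_left, (hasSum_hurwitzZetaC_mul_pow ha hya).tsum_eq,
      ← deriv_hankelIntegral_one_eq_digamma ha, Nat.add_sub_cancel,
      mul_div_cancel_left₀ _ hne]
    ring
  -- At `y = 0` only the term `k = q` of the sum survives, and it equals the subtracted `g(q, a)`.
  have hF0 : F 0 = 0 := by
    simp only [hF]
    rw [Finset.sum_range_succ, Finset.sum_eq_zero fun k hk => ?_]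
    · simp
    · have : q - k ≠ 0 := by have := Finset.mem_range.1 hk; omega
      simp [this]
  -- With derivative bound `0`, the series minus `F` is constant on the disc.
  have hconst := Convex.norm_image_sub_le_of_norm_hasDerivWithin_le (C := 0)
    (fun y hy => (hFd y hy).hasDerivWithinAt) (fun y _ => by simp) (convex_ball 0 r) h0mem htmem
  have hEq : (∑' n, S n t) = F t := by
    rw [zero_mul, norm_le_zero_iff, hF0] at hconst
    simp only [hS0, tsum_zero, sub_zero] at hconst
    exact sub_eq_zero.1 hconst
  have hfin := hsum.hasSum
  rwa [hEq] at hfin
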